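/- **Setting.** Let $\mathfrak h$ be a real separable Hilbert space with complexification $\mathfrak h_{\mathbb C}$ and conjugation $k\mapsto\overline k$ (inner products are antilinear in the first variable). Let $\mathfrak H=\bigoplus_{n\ge 0}\mathfrak h_{\mathbb C}^{\odot n}$ be the symmetric Fock space, $\mathcal E(k)=\sum_n k^{\otimes n}/\sqrt{n!}$ the exponential vectors, $\Omega=\mathcal E(0)$ and $\mathbb E(X)=\langle\Omega,X\Omega\rangle$ for $X\in\mathcal B(\mathfrak H)$. Let $a(h),a^+(h)$ be the annihilation and creation operators, $Q(h)=a(\overline h)+a^+(h)$ and $P(h)=i\,(a(\overline h)-a^+(h))$ for $h\in\mathfrak h_{\mathbb C}$. An expression $\sum_j X_jB_jY_j$ with $B_j\in\mathcal B(\mathfrak H)$ and $X_j,Y_j$ operators which, like their adjoints, are defined on exponential vectors *defines the bounded operator* $M$ if $\langle\mathcal E(f),M\mathcal E(g)\rangle=\sum_j\langle X_j^*\mathcal E(f),B_jY_j\mathcal E(g)\rangle$ for all $f,g\in\mathfrak h_{\mathbb C}$; commutators with the unbounded operators $P,Q$ are understood in this sense. **Weyl calculus.** For $h_1,h_2\in\mathfrak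 h$ let $U(h_1,h_2)=\exp(iP(h_1)+iQ(h_2))$, the unitary operator with $U(h_1,h_2)\mathcal E(f)=e^{-\|z\|^2/2-\langle z,f\rangle}\mathcal E(f+z)$, $z=h_1+ih_2$. For $h=(h_1,h_2)\in\mathfrak h\otimes\mathbb R^2$ and $\varphi:\mathbb R^2\to\mathbb C$, one says $\varphi\in\mathrm{Dom}\,O_h$ and $O_h(\varphi)=M\in\mathcal B(\mathfrak H)$ if for all $k_1,k_2\in\mathfrak h_{\mathbb C}$ $$\langle\mathcal E(k_1),M\mathcal E(k_2)\rangle=\frac1{2\pi}\int\langle\mathcal E(k_1),U(uh_1,vh_2)\mathcal E(k_2)\rangle\,\mathcal F^{-1}\varphi(u,v)\,du\,dv ,\qquad \mathcal F^{-1}\varphi(u,v)=\frac1{2\pi}\int\varphi(x,y)e^{-i(ux+vy)}dx\,dy,$$ where $\mathcal F^{-1}\varphi$ is taken in the sense of distributions: the right-hand side means $\int\varphi\,dW$ (with $\varphi$ integrable for $W$), where $W$ is the complex measure on $\mathbb R^2$ with $\int e^{i(ux+vy)}dW(x,y)=\langle\mathcal E(k_1),U(uh_1,vh_2)\mathcal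 E(k_2)\rangle$. **Derivation.** $\mathcal S$ is the algebra generated by all $O_h(\varphi)$ with $h\in\mathfrak h\otimes\mathbb R^2$ and $\varphi\in C^\infty(\mathbb R^2)$ such that all partial derivatives of $\varphi$ of all orders (including $\varphi$) are in $\mathrm{Dom}\,O_h$. Let $\mathfrak M=\mathcal B(\mathfrak H,\mathfrak H\otimes\mathfrak h_{\mathbb C}\otimes\mathbb C^2)$, with $O\otimes k$ the operator $v\mapsto Ov\otimes k$, with the bimodule structure $O\cdot(O_1\otimes k)=OO_1\otimes k$, $(O_1\otimes k)\cdot O=O_1O\otimes k$, and with the $\mathcal B(\mathfrak H)$-valued inner product $\langle\alpha,\beta\rangle=\alpha^*\beta$. $D$ is the derivation on $\mathcal S$ with values in $\mathfrak M$ determined by $DO_h(\varphi)=\big(O_h(\partial_x\varphi)\otimes h_1,\;O_h(\partial_y\varphi)\otimes h_2\big)$, and the same symbol $D$ denotes its closure with respect to the weak operator topologies on $\mathcal B(\mathfrak H)$ and $\mathfrak M$. For $k\in\mathfrak h_{\mathbb C}\otimes\mathbb C^2$ put $D_kB=\frac i2[Q(k_1)-P(k_2),B]$. **Gradients and divergence.**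 For $u=\sum_{j=1}^nF_j\otimes h^{(j)}$ with $F_j\in\mathcal S$ and $h^{(j)}\in\mathfrak h_{\mathbb C}\otimes\mathbb C^2$, let $\overline u=\sum_jF_j^*\otimes\overline{h^{(j)}}$, and for $A,B\in\mathrm{Dom}\,D$ let $$A\overleftrightarrow D_uB=A\,\langle\overline u,DB\rangle+\Big(\sum_{j=1}^n\big\langle\overline{h^{(j)}},DA\big\rangle F_j\Big)B .$$ (The sum in brackets is the left gradient $\langle\overline{DA},u\rangle$ of $A$; here $k\in\mathfrak h_{\mathbb C}\otimes\mathbb C^2$ is identified with $\mathrm{id}\otimes k\in\mathfrak M$.) Such a $u$ belongs to $\mathcal S_{\mathfrak h,\delta}$ if $$\delta(u)=\frac12\sum_{j=1}^n\big\{P(h^{(j)}_1)+Q(h^{(j)}_2),F_j\big\}-\sum_{j=1}^nD_{h^{(j)}}F_j$$ defines a bounded operator, which is then denoted by $\delta(u)$; here $\{X,Y\}=XY+YX$. **Proposition.** Let $u=\sum_{j=1}^nF_j\otimes h^{(j)}\in\mathcal S_{\mathfrak h,\delta}$ and let $A,B\in\mathrm{Dom}\,D$ commute with each of the operators $P(h^{(j)}_1)+Q(h^{(j)}_2)$,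 $j=1,\dots,n$, that is, $[P(h^{(j)}_1)+Q(h^{(j)}_2),A]=0=[P(h^{(j)}_1)+Q(h^{(j)}_2),B]$. Then $$\mathbb E\big(A\,\delta(u)\,B\big)=\mathbb E\big(A\overleftrightarrow D_uB\big).$$ -/

import Mathlib

open UniformSpace MeasureTheory
open scoped TensorProduct ComplexConjugate InnerProductSpace

noncomputable section

set_option linter.unusedSectionVars false

namespace QMalliavin

universe u

/-! ### The complexification of a real Hilbert space -/

/-- The complexification of the real Hilbert space `𝔥`; `⟨x, y⟩` stands for `x + i y`. -/
@[ext]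
structure Cplx (𝔥 : Type u) : Type u where
  re : 𝔥
  im : 𝔥

namespace Cplx

variable {𝔥 : Type u} [NormedAddCommGroup 𝔥] [InnerProductSpace ℝ 𝔥]

instance : Zero (Cplx 𝔥) := ⟨⟨0, 0⟩⟩
instance : Add (Cplx 𝔥) := ⟨fun x y => ⟨x.re + y.re, x.im + y.im⟩⟩
instance : Neg (Cplx 𝔥) := ⟨fun x => ⟨-x.re, -x.im⟩⟩
instance : SMul ℂ (Cplx 𝔥) :=
  ⟨fun c x => ⟨c.re • x.re - c.im • x.im, c.re • x.im + c.im • x.re⟩⟩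

@[simp] theorem zero_re : (0 : Cplx 𝔥).re = 0 := rfl
@[simp] theorem zero_im : (0 : Cplx 𝔥).im = 0 := rfl
@[simp] theorem add_re (x y : Cplx 𝔥) : (x + y).re = x.re + y.re := rfl
@[simp] theorem add_im (x y : Cplx 𝔥) : (x + y).im = x.im + y.im := rfl
@[simp] theorem neg_re (x : Cplx 𝔥) : (-x).re = -x.re := rfl
@[simp] theorem neg_im (x : Cplx 𝔥) : (-x).im = -x.im := rfl
@[simp] theorem smul_re (c : ℂ) (x : Cplx 𝔥) : (c • x).re = c.re • x.re - c.im • x.im := rfl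
@[simp] theorem smul_im (c : ℂ) (x : Cplx 𝔥) : (c • x).im = c.re • x.im + c.im • x.re := rfl

instance : AddCommGroup (Cplx 𝔥) where
  add_assoc x y z := by ext <;> simp [add_assoc]
  zero_add x := by ext <;> simp
  add_zero x := by ext <;> simp
  nsmul := nsmulRec
  zsmul := zsmulRec
  neg_add_cancel x := by ext <;> simp
  add_comm x y := by ext <;> simp [add_comm]

instance : Module ℂ (Cplx 𝔥) where
  one_smul x := by ext <;> simp
  mul_smul c d x := by ext <;> simp <;> module
  smul_zero c := by ext <;> simp
  smul_add c x y := by ext <;> simp <;> abel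
  add_smul c d x := by ext <;> simp <;> module
  zero_smul x := by ext <;> simp

/-- `⟨x₁ + i x₂, y₁ + i y₂⟩`, antilinear in the first argument. -/
@[reducible]
def innerCore : InnerProductSpace.Core ℂ (Cplx 𝔥) where
  inner x y := ⟨⟪x.re, y.re⟫_ℝ + ⟪x.im, y.im⟫_ℝ, ⟪x.re, y.im⟫_ℝ - ⟪x.im, y.re⟫_ℝ⟩
  conj_inner_symm x y := by
    apply Complex.ext <;> simp [real_inner_comm]
  re_inner_nonneg x := by
    simpa using add_nonneg real_inner_self_nonneg real_inner_self_nonneg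
  add_left x y z := by
    apply Complex.ext <;> simp [inner_add_left] <;> ring
  smul_left x y c := by
    apply Complex.ext <;> simp [inner_add_left, inner_sub_left, inner_smul_left] <;> ring
  definite x hx := by
    have h := congrArg Complex.re hx
    simp only [Complex.zero_re] at h
    have h1 : 0 ≤ ⟪x.re, x.re⟫_ℝ := real_inner_self_nonneg
    have h2 : 0 ≤ ⟪x.im, x.im⟫_ℝ := real_inner_self_nonneg
    ext
    · exact inner_self_eq_zero.1 (by linarith : ⟪x.re, x.re⟫_ℝ = 0)
    · exact inner_self_eq_zero.1 (by linarith : ⟪x.im, x.im⟫_ℝ = 0)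

instance : NormedAddCommGroup (Cplx 𝔥) := (innerCore (𝔥 := 𝔥)).toNormedAddCommGroup
instance : InnerProductSpace ℂ (Cplx 𝔥) := .ofCore innerCore.toCore

theorem inner_def (x y : Cplx 𝔥) : ⟪x, y⟫_ℂ =
    ⟨⟪x.re, y.re⟫_ℝ + ⟪x.im, y.im⟫_ℝ, ⟪x.re, y.im⟫_ℝ - ⟪x.im, y.re⟫_ℝ⟩ := rfl

/-- The conjugation `x + i y ↦ x - i y`. -/
def bar (x : Cplx 𝔥) : Cplx 𝔥 := ⟨x.re, -x.im⟩

/-- The inclusion `𝔥 → 𝔥_ℂ`. -/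
def ofReal (x : 𝔥) : Cplx 𝔥 := ⟨x, 0⟩

end Cplx

/-! ### Hilbert tensor powers -/

/-- A Hilbert space with its structure. -/
structure HilbertBundle : Type (u + 1) where
  carrier : Type u
  nacg : NormedAddCommGroup carrier
  ips : InnerProductSpace ℂ carrier
  complete : CompleteSpace carrier

/-- The Hilbert space `K^{⊗ n}`: `K^{⊗ 0}` is one-dimensional and `K^{⊗ (n+1)}` is the completion of
`K ⊗ K^{⊗ n}`. -/
def tensorPowBundle (K : Type u) [NormedAddCommGroup K] [InnerProductSpace ℂ K] :
    ℕ → HilbertBundle.{u}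
  | 0 => ⟨EuclideanSpace ℂ PUnit.{u + 1}, inferInstance, inferInstance, inferInstance⟩
  | n + 1 =>
    letI := (tensorPowBundle K n).nacg
    letI := (tensorPowBundle K n).ips
    ⟨Completion (K ⊗[ℂ] (tensorPowBundle K n).carrier), inferInstance, inferInstance,
      inferInstance⟩

/-- The `n`-th Hilbert tensor power of `K`. -/
def TensorPow (K : Type u) [NormedAddCommGroup K] [InnerProductSpace ℂ K] (n : ℕ) : Type u :=
  (tensorPowBundle K n).carrier

section TensorPow

variable {K : Type u} [NormedAddCommGroup K] [InnerProductSpace ℂ K]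

instance (n : ℕ) : NormedAddCommGroup (TensorPow K n) := (tensorPowBundle K n).nacg
instance (n : ℕ) : InnerProductSpace ℂ (TensorPow K n) := (tensorPowBundle K n).ips
instance (n : ℕ) : CompleteSpace (TensorPow K n) := (tensorPowBundle K n).complete

/-- The unit vector `1 ∈ K^{⊗ 0}`. -/
def tensorOne : TensorPow K 0 :=
  (EuclideanSpace.single PUnit.unit 1 : EuclideanSpace ℂ PUnit.{u + 1})

/-- The bilinear map `(k, x) ↦ k ⊗ x`, `K × K^{⊗ n} → K^{⊗ (n+1)}`. -/
def tensorCons (n : ℕ) : K →L[ℂ] TensorPow K n →L[ℂ] TensorPow K (n + 1) :=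
  (ContinuousLinearMap.compL ℂ (TensorPow K n) (K ⊗[ℂ] TensorPow K n)
    (Completion (K ⊗[ℂ] TensorPow K n)) Completion.toComplL).comp
    (TensorProduct.mkL ℂ K (TensorPow K n))

/-- The vector `k^{⊗ n}`. -/
def purePow (k : K) : (n : ℕ) → TensorPow K n
  | 0 => tensorOne
  | n + 1 => tensorCons n k (purePow k n)

theorem inner_tensorOne : ⟪(tensorOne : TensorPow K 0), tensorOne⟫_ℂ = 1 := by
  change ⟪(EuclideanSpace.single PUnit.unit 1 : EuclideanSpace ℂ PUnit.{u + 1}),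
    EuclideanSpace.single PUnit.unit 1⟫_ℂ = 1
  simp

theorem inner_tensorCons (n : ℕ) (k l : K) (x y : TensorPow K n) :
    ⟪tensorCons n k x, tensorCons n l y⟫_ℂ = ⟪k, l⟫_ℂ * ⟪x, y⟫_ℂ := by
  change ⟪((k ⊗ₜ[ℂ] x : K ⊗[ℂ] TensorPow K n) : Completion (K ⊗[ℂ] TensorPow K n)),
    ((l ⊗ₜ[ℂ] y : K ⊗[ℂ] TensorPow K n) : Completion (K ⊗[ℂ] TensorPow K n))⟫_ℂ = _
  rw [Completion.inner_coe, TensorProduct.inner_tmul]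

theorem inner_purePow (k l : K) (n : ℕ) : ⟪purePow k n, purePow l n⟫_ℂ = ⟪k, l⟫_ℂ ^ n := by
  induction n with
  | zero => simpa [purePow] using inner_tensorOne (K := K)
  | succ n ih => rw [purePow, purePow, inner_tensorCons, ih, pow_succ']

theorem norm_tensorCons (n : ℕ) (k : K) (x : TensorPow K n) :
    ‖tensorCons n k x‖ = ‖k‖ * ‖x‖ := by
  have h := inner_tensorCons n k k x x
  simp only [inner_self_eq_norm_sq_to_K] at h
  have h' : ‖tensorCons n k x‖ ^ 2 = (‖k‖ * ‖x‖) ^ 2 := by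
    rw [mul_pow]; exact_mod_cast h
  exact (pow_left_inj₀ (norm_nonneg _) (by positivity) two_ne_zero).1 h'

theorem norm_purePow (k : K) (n : ℕ) : ‖purePow k n‖ = ‖k‖ ^ n := by
  induction n with
  | zero =>
    have h := inner_tensorOne (K := K)
    rw [inner_self_eq_norm_sq_to_K] at h
    have h' : ‖(tensorOne : TensorPow K 0)‖ ^ 2 = 1 :=
      Complex.ofReal_injective (by rw [Complex.ofReal_pow]; simpa using h)
    simpa [purePow] using (pow_eq_one_iff_of_nonneg (norm_nonneg _) two_ne_zero).1 h'
  | succ n ih => rw [purePow, norm_tensorCons, ih, pow_succ']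

variable (K) in
/-- The symmetric tensor power `K^{⊙ n}`, the closed linear span of the vectors `k^{⊗ n}`. -/
def symPow (n : ℕ) : Submodule ℂ (TensorPow K n) :=
  (Submodule.span ℂ (Set.range fun k : K => purePow k n)).topologicalClosure

instance (n : ℕ) : CompleteSpace (symPow K n) :=
  inferInstanceAs (CompleteSpace (Submodule.topologicalClosure _))

/-- The vector `k^{⊗ n}`, as an element of `K^{⊙ n}`. -/
def symPurePow (k : K) (n : ℕ) : symPow K n :=
  ⟨purePow k n, Submodule.le_topologicalClosure _ (Submodule.subset_span ⟨k, rfl⟩)⟩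

/-- The map `x ↦ √(n+1) Sym (h ⊗ x)`, `K^{⊙ n} → K^{⊙ (n+1)}`, where `Sym` is the orthogonal
projection of `K^{⊗ (n+1)}` onto `K^{⊙ (n+1)}`. -/
def createLevel (h : K) (n : ℕ) : symPow K n →L[ℂ] symPow K (n + 1) :=
  ((Real.sqrt (n + 1) : ℝ) : ℂ) •
    (((symPow K (n + 1)).orthogonalProjectionOnto).comp ((tensorCons n h).comp (symPow K n).subtypeL))

/-- The adjoint of `createLevel h n`. -/
def annihilateLevel (h : K) (n : ℕ) : symPow K (n + 1) →L[ℂ] symPow K n :=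
  ContinuousLinearMap.adjoint (createLevel h n)

end TensorPow

/-! ### Hilbert space tensor products -/

/-- The Hilbert space tensor product of `E` and `F`. -/
def HilbertTensor (E : Type u) (F : Type u) [NormedAddCommGroup E] [InnerProductSpace ℂ E]
    [NormedAddCommGroup F] [InnerProductSpace ℂ F] : Type u :=
  Completion (E ⊗[ℂ] F)

section HilbertTensor

variable {E F : Type u} [NormedAddCommGroup E] [InnerProductSpace ℂ E]
  [NormedAddCommGroup F] [InnerProductSpace ℂ F]

instance : NormedAddCommGroup (HilbertTensor E F) :=
  inferInstanceAs (NormedAddCommGroup (Completion (E ⊗[ℂ] F)))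

instance : InnerProductSpace ℂ (HilbertTensor E F) :=
  inferInstanceAs (InnerProductSpace ℂ (Completion (E ⊗[ℂ] F)))

instance : CompleteSpace (HilbertTensor E F) :=
  inferInstanceAs (CompleteSpace (Completion (E ⊗[ℂ] F)))

variable (E F) in
/-- The bilinear map `(x, y) ↦ x ⊗ y`. -/
def hTmul : E →L[ℂ] F →L[ℂ] HilbertTensor E F :=
  (ContinuousLinearMap.compL ℂ F (E ⊗[ℂ] F) (Completion (E ⊗[ℂ] F)) Completion.toComplL).comp
    (TensorProduct.mkL ℂ E F)

theorem inner_hTmul (x x' : E) (y y' : F) :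
    ⟪hTmul E F x y, hTmul E F x' y'⟫_ℂ = ⟪x, x'⟫_ℂ * ⟪y, y'⟫_ℂ := by
  change ⟪((x ⊗ₜ[ℂ] y : E ⊗[ℂ] F) : Completion (E ⊗[ℂ] F)),
    ((x' ⊗ₜ[ℂ] y' : E ⊗[ℂ] F) : Completion (E ⊗[ℂ] F))⟫_ℂ = _
  rw [Completion.inner_coe, TensorProduct.inner_tmul]

/-- The operator `O ⊗ id` on `E ⊗ F`. -/
def ampliation (O : E →L[ℂ] E) : HilbertTensor E F →L[ℂ] HilbertTensor E F :=
  ((O.rTensor F).completion : Completion (E ⊗[ℂ] F) →L[ℂ] Completion (E ⊗[ℂ] F))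

theorem ampliation_hTmul (O : E →L[ℂ] E) (x : E) (y : F) :
    ampliation O (hTmul E F x y) = hTmul E F (O x) y :=
  ContinuousLinearMap.completion_apply_coe (O.rTensor F) (x ⊗ₜ[ℂ] y)

end HilbertTensor

/-! ### The symmetric Fock space -/

/-- The symmetric Fock space `⨁ₙ (𝔥_ℂ)^{⊙ n}` (Hilbert space direct sum). -/
abbrev Fock (𝔥 : Type u) [NormedAddCommGroup 𝔥] [InnerProductSpace ℝ 𝔥] : Type u :=
  lp (fun n : ℕ => symPow (Cplx 𝔥) n) 2

section Fock

variable {𝔥 : Type u} [NormedAddCommGroup 𝔥] [InnerProductSpace ℝ 𝔥]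

theorem norm_symPurePow (k : Cplx 𝔥) (n : ℕ) : ‖symPurePow k n‖ = ‖k‖ ^ n := norm_purePow k n

theorem memℓp_expVec (k : Cplx 𝔥) : Memℓp (E := fun n : ℕ => symPow (Cplx 𝔥) n)
    (fun n => ((Real.sqrt n.factorial : ℝ) : ℂ)⁻¹ • symPurePow k n) 2 := by
  apply memℓp_gen
  refine (Real.summable_pow_div_factorial (‖k‖ ^ 2)).congr fun n => ?_
  rw [norm_smul, norm_symPurePow, norm_inv, Complex.norm_real, Real.norm_of_nonneg (by positivity)]
  simp only [ENNReal.toReal_ofNat, Real.rpow_ofNat]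
  rw [mul_pow, inv_pow, Real.sq_sqrt (by positivity), ← pow_mul, ← pow_mul, mul_comm 2 n]
  field_simp

/-- The exponential vector `ℰ(k) = ∑ₙ k^{⊗ n} / √(n!)`. -/
def expVec (k : Cplx 𝔥) : Fock 𝔥 := ⟨_, memℓp_expVec k⟩

/-- The vacuum vector `Ω = ℰ(0)`. -/
def vacuumVec : Fock 𝔥 := expVec 0

/-- The vacuum expectation `𝔼(X) = ⟨Ω, X Ω⟩`. -/
def vacuumState (X : Fock 𝔥 →L[ℂ] Fock 𝔥) : ℂ := ⟪(vacuumVec : Fock 𝔥), X vacuumVec⟫_ℂ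

/-- The sequence of components of `a⁺(h) x`. -/
def createSeq (h : Cplx 𝔥) (x : ∀ n : ℕ, symPow (Cplx 𝔥) n) : ∀ n : ℕ, symPow (Cplx 𝔥) n
  | 0 => 0
  | n + 1 => createLevel h n (x n)

/-- The sequence of components of `a(h) x`. -/
def annihilateSeq (h : Cplx 𝔥) (x : ∀ n : ℕ, symPow (Cplx 𝔥) n) (n : ℕ) : symPow (Cplx 𝔥) n :=
  annihilateLevel h n (x (n + 1))

theorem createSeq_add (h : Cplx 𝔥) (x y : ∀ n : ℕ, symPow (Cplx 𝔥) n) :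
    createSeq h (x + y) = createSeq h x + createSeq h y := by
  funext n
  cases n with
  | zero => simp [createSeq]
  | succ n => simp [createSeq]

theorem createSeq_smul (h : Cplx 𝔥) (c : ℂ) (x : ∀ n : ℕ, symPow (Cplx 𝔥) n) :
    createSeq h (c • x) = c • createSeq h x := by
  funext n
  cases n with
  | zero => simp [createSeq]
  | succ n => simp [createSeq]

theorem annihilateSeq_add (h : Cplx 𝔥) (x y : ∀ n : ℕ, symPow (Cplx 𝔥) n) :
    annihilateSeq h (x + y) = annihilateSeq h x + annihilateSeq h y := by
  funext n; simp [annihilateSeq]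

theorem annihilateSeq_smul (h : Cplx 𝔥) (c : ℂ) (x : ∀ n : ℕ, symPow (Cplx 𝔥) n) :
    annihilateSeq h (c • x) = c • annihilateSeq h x := by
  funext n; simp [annihilateSeq]

/-- The creation operator `a⁺(h)` on its maximal domain. -/
def creation (h : Cplx 𝔥) : Fock 𝔥 →ₗ.[ℂ] Fock 𝔥 where
  domain :=
    { carrier := {x | Memℓp (createSeq h x) 2}
      add_mem' := fun {x y} hx hy => by
        change Memℓp (createSeq h (⇑x + ⇑y)) 2
        rw [createSeq_add]; exact hx.add hy
      zero_mem' := by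
        change Memℓp (createSeq h (0 : ∀ n : ℕ, symPow (Cplx 𝔥) n)) 2
        have h0 := createSeq_smul h 0 (0 : ∀ n : ℕ, symPow (Cplx 𝔥) n)
        rw [zero_smul, zero_smul] at h0
        rw [h0]; exact zero_memℓp
      smul_mem' := fun c x hx => by
        change Memℓp (createSeq h (c • ⇑x)) 2
        rw [createSeq_smul]; exact hx.const_smul c }
  toFun :=
    { toFun := fun x => ⟨createSeq h x.1, x.2⟩
      map_add' := fun x y => Subtype.ext (createSeq_add h x.1 y.1)
      map_smul' := fun c x => Subtype.ext (createSeq_smul h c x.1) }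

/-- The annihilation operator `a(h)` on its maximal domain. -/
def annihilation (h : Cplx 𝔥) : Fock 𝔥 →ₗ.[ℂ] Fock 𝔥 where
  domain :=
    { carrier := {x | Memℓp (annihilateSeq h x) 2}
      add_mem' := fun {x y} hx hy => by
        change Memℓp (annihilateSeq h (⇑x + ⇑y)) 2
        rw [annihilateSeq_add]; exact hx.add hy
      zero_mem' := by
        change Memℓp (annihilateSeq h (0 : ∀ n : ℕ, symPow (Cplx 𝔥) n)) 2
        have h0 := annihilateSeq_smul h 0 (0 : ∀ n : ℕ, symPow (Cplx 𝔥) n)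
        rw [zero_smul, zero_smul] at h0
        rw [h0]; exact zero_memℓp
      smul_mem' := fun c x hx => by
        change Memℓp (annihilateSeq h (c • ⇑x)) 2
        rw [annihilateSeq_smul]; exact hx.const_smul c }
  toFun :=
    { toFun := fun x => ⟨annihilateSeq h x.1, x.2⟩
      map_add' := fun x y => Subtype.ext (annihilateSeq_add h x.1 y.1)
      map_smul' := fun c x => Subtype.ext (annihilateSeq_smul h c x.1) }

theorem createLevel_norm_le (h : Cplx 𝔥) (n : ℕ) (x : symPow (Cplx 𝔥) n) :
    ‖createLevel h n x‖ ≤ Real.sqrt (n + 1) * (‖h‖ * ‖x‖) := by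
  change ‖((Real.sqrt (n + 1) : ℝ) : ℂ) • ((symPow (Cplx 𝔥) (n + 1)).orthogonalProjectionOnto
    (tensorCons n h (x : TensorPow (Cplx 𝔥) n)))‖ ≤ _
  rw [norm_smul, Complex.norm_real, Real.norm_of_nonneg (Real.sqrt_nonneg _)]
  refine mul_le_mul_of_nonneg_left ?_ (Real.sqrt_nonneg _)
  refine (Submodule.norm_orthogonalProjectionOnto_apply_le _ _).trans ?_
  rw [norm_tensorCons, Submodule.coe_norm]

theorem annihilateLevel_symPurePow (h k : Cplx 𝔥) (n : ℕ) :
    annihilateLevel h n (symPurePow k (n + 1)) =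
      (((Real.sqrt (n + 1) : ℝ) : ℂ) * ⟪h, k⟫_ℂ) • symPurePow k n := by
  refine ext_inner_left ℂ fun y => ?_
  rw [annihilateLevel, ContinuousLinearMap.adjoint_inner_right, inner_smul_right]
  change ⟪((Real.sqrt (n + 1) : ℝ) : ℂ) • ((symPow (Cplx 𝔥) (n + 1)).orthogonalProjectionOnto
    (tensorCons n h (y : TensorPow (Cplx 𝔥) n))), symPurePow k (n + 1)⟫_ℂ = _
  rw [inner_smul_left, Submodule.inner_orthogonalProjectionOnto_eq_of_mem_right]
  change _ * ⟪tensorCons n h (y : TensorPow (Cplx 𝔥) n), tensorCons n k (purePow k n)⟫_ℂ = _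
  rw [inner_tensorCons, Complex.conj_ofReal, ← mul_assoc]
  rfl

theorem annihilateSeq_expVec (h k : Cplx 𝔥) :
    annihilateSeq h (expVec k : Fock 𝔥) = ⟪h, k⟫_ℂ • ⇑(expVec k : Fock 𝔥) := by
  funext n
  change annihilateLevel h n (((Real.sqrt (n + 1).factorial : ℝ) : ℂ)⁻¹ • symPurePow k (n + 1)) =
    ⟪h, k⟫_ℂ • (((Real.sqrt n.factorial : ℝ) : ℂ)⁻¹ • symPurePow k n)
  rw [map_smul, annihilateLevel_symPurePow, smul_smul, smul_smul, Nat.factorial_succ]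
  congr 1
  have h1 : ((Real.sqrt (n + 1) : ℝ) : ℂ) ≠ 0 := by
    exact_mod_cast (Real.sqrt_pos.2 (by positivity)).ne'
  have h2 : ((Real.sqrt n.factorial : ℝ) : ℂ) ≠ 0 := by
    exact_mod_cast (Real.sqrt_pos.2 (by positivity)).ne'
  push_cast
  rw [Real.sqrt_mul (by positivity)]
  push_cast
  field_simp

/-- Exponential vectors are in the domain of the annihilation operators. -/
theorem expVec_mem_annihilation (h k : Cplx 𝔥) : expVec k ∈ (annihilation h).domain := by
  change Memℓp (annihilateSeq h (expVec k : Fock 𝔥)) 2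
  rw [annihilateSeq_expVec]
  exact (lp.memℓp (expVec k)).const_smul _

/-- Exponential vectors are in the domain of the creation operators. -/
theorem expVec_mem_creation (h k : Cplx 𝔥) : expVec k ∈ (creation h).domain := by
  change Memℓp (createSeq h (expVec k : Fock 𝔥)) 2
  apply memℓp_gen
  simp only [ENNReal.toReal_ofNat, Real.rpow_ofNat]
  rw [← summable_nat_add_iff 1]
  have hs : Summable fun n : ℕ => ((n : ℝ) + 1) * ((‖k‖ ^ 2) ^ n / n.factorial) := by
    rw [← summable_nat_add_iff 1]
    have h1 := Real.summable_pow_div_factorial (‖k‖ ^ 2)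
    have h2 := (summable_nat_add_iff 1).2 h1
    refine ((h1.mul_left (‖k‖ ^ 2)).add h2).congr fun n => ?_
    rw [Nat.factorial_succ]
    push_cast
    field_simp
    ring
  refine Summable.of_nonneg_of_le (fun n => by positivity) (fun n => ?_) (hs.mul_left (‖h‖ ^ 2))
  change ‖createLevel h n (((Real.sqrt n.factorial : ℝ) : ℂ)⁻¹ • symPurePow k n)‖ ^ 2 ≤ _
  refine (pow_le_pow_left₀ (norm_nonneg _) (createLevel_norm_le h n _) 2).trans (le_of_eq ?_)
  rw [norm_smul, norm_symPurePow, norm_inv, Complex.norm_real,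
    Real.norm_of_nonneg (Real.sqrt_nonneg _)]
  simp only [mul_pow, inv_pow]
  rw [Real.sq_sqrt (by positivity), Real.sq_sqrt (by positivity), ← pow_mul, ← pow_mul,
    mul_comm 2 n]
  field_simp

/-- The position operator `Q(h) = a(h̄) + a⁺(h)`. -/
def position (h : Cplx 𝔥) : Fock 𝔥 →ₗ.[ℂ] Fock 𝔥 := annihilation h.bar + creation h

/-- The momentum operator `P(h) = i (a(h̄) - a⁺(h))`. -/
def momentum (h : Cplx 𝔥) : Fock 𝔥 →ₗ.[ℂ] Fock 𝔥 :=
  Complex.I • (annihilation h.bar - creation h)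

theorem expVec_mem_position (h k : Cplx 𝔥) : expVec k ∈ (position h).domain :=
  ⟨expVec_mem_annihilation _ _, expVec_mem_creation _ _⟩

theorem expVec_mem_momentum (h k : Cplx 𝔥) : expVec k ∈ (momentum h).domain :=
  ⟨expVec_mem_annihilation _ _, expVec_mem_creation _ _⟩

/-- Componentwise conjugation on `𝔥_ℂ ⊗ ℂ²`. -/
def bar₂ (k : Cplx 𝔥 × Cplx 𝔥) : Cplx 𝔥 × Cplx 𝔥 := (k.1.bar, k.2.bar)

/-- The field operator `P(k₁) + Q(k₂)`. -/
def field (k : Cplx 𝔥 × Cplx 𝔥) : Fock 𝔥 →ₗ.[ℂ] Fock 𝔥 := momentum k.1 + position k.2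

/-- The conjugate field operator `Q(k₁) - P(k₂)`. -/
def cofield (k : Cplx 𝔥 × Cplx 𝔥) : Fock 𝔥 →ₗ.[ℂ] Fock 𝔥 := position k.1 - momentum k.2

/-- The vector `(P(k₁) + Q(k₂)) ℰ(f)`. On exponential vectors, the adjoint of `P(k₁) + Q(k₂)` is
`P(k̄₁) + Q(k̄₂)`. -/
def fieldExp (k : Cplx 𝔥 × Cplx 𝔥) (f : Cplx 𝔥) : Fock 𝔥 :=
  field k ⟨expVec f, expVec_mem_momentum _ _, expVec_mem_position _ _⟩

/-- The vector `(Q(k₁) - P(k₂)) ℰ(f)`. On exponential vectors, the adjoint of `Q(k₁) - P(k₂)` is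
`Q(k̄₁) - P(k̄₂)`. -/
def cofieldExp (k : Cplx 𝔥 × Cplx 𝔥) (f : Cplx 𝔥) : Fock 𝔥 :=
  cofield k ⟨expVec f, expVec_mem_position _ _, expVec_mem_momentum _ _⟩

/-- The vector `U(h₁, h₂) ℰ(f) = exp(-‖z‖²/2 - ⟨z, f⟩) ℰ(f + z)`, `z = h₁ + i h₂`, where
`U(h₁, h₂) = exp(i P(h₁) + i Q(h₂))`, for `h₁, h₂` in `𝔥`, is the unitary Weyl operator. -/
def weylExp (h₁ h₂ : 𝔥) (f : Cplx 𝔥) : Fock 𝔥 :=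
  let z : Cplx 𝔥 := ⟨h₁, h₂⟩
  Complex.exp (-((‖z‖ ^ 2 : ℝ) : ℂ) / 2 - ⟪z, f⟫_ℂ) • expVec (f + z)

/-! ### Expressions that define bounded operators -/

/-- The bounded operators on the Fock space. -/
abbrev BFock (𝔥 : Type u) [NormedAddCommGroup 𝔥] [InnerProductSpace ℝ 𝔥] : Type u :=
  Fock 𝔥 →L[ℂ] Fock 𝔥

/-- The bounded operator `M` has the matrix elements `q f g` between exponential vectors. -/
def HasMatrix (M : BFock 𝔥) (q : Cplx 𝔥 → Cplx 𝔥 → ℂ) : Prop :=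
  ∀ f g, ⟪expVec f, M (expVec g)⟫_ℂ = q f g

/-- The matrix elements `q` between exponential vectors define a bounded operator. -/
def DefinesBounded (q : Cplx 𝔥 → Cplx 𝔥 → ℂ) : Prop := ∃ M : BFock 𝔥, HasMatrix M q

open Classical in
/-- The bounded operator with matrix elements `q` (and `0` if there is none). -/
def boundedOf (q : Cplx 𝔥 → Cplx 𝔥 → ℂ) : BFock 𝔥 :=
  if h : DefinesBounded q then h.choose else 0

/-! ### Weyl calculus -/

/-- The complex measure `ρ μ` on `ℝ²` has the Fourier transform
`g(u, v) = ∫ exp(i (u x + v y)) ρ(x, y) dμ(x, y)`. -/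
def HasFourierTransform (μ : Measure (ℝ × ℝ)) (ρ : ℝ × ℝ → ℂ) (g : ℝ → ℝ → ℂ) : Prop :=
  Integrable ρ μ ∧
    ∀ u v : ℝ, g u v = ∫ p, Complex.exp (Complex.I * (u * p.1 + v * p.2)) * ρ p ∂μ

/-- `c = (1/2π) ∫ g(u, v) (F⁻¹φ)(u, v) du dv`, where `F⁻¹φ` is the inverse Fourier transform of `φ`
in the sense of distributions, `F⁻¹φ(u, v) = (1/2π) ∫ φ(x, y) exp(-i (u x + v y)) dx dy`, and `g` is
the Fourier transform of a complex measure `W`: by the definition of the Fourier transform of a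
distribution, this is `∫ φ dW`. The complex measure `W = ρ μ` is unique. -/
def IsFourierPairing (φ : ℝ × ℝ → ℂ) (g : ℝ → ℝ → ℂ) (c : ℂ) : Prop :=
  (∃ (μ : Measure (ℝ × ℝ)) (ρ : ℝ × ℝ → ℂ), IsFiniteMeasure μ ∧ HasFourierTransform μ ρ g) ∧
    ∀ (μ : Measure (ℝ × ℝ)) (ρ : ℝ × ℝ → ℂ), IsFiniteMeasure μ → HasFourierTransform μ ρ g →
      Integrable (fun p => φ p * ρ p) μ ∧ ∫ p, φ p * ρ p ∂μ = c

/-- `M = O_h(φ)`: the matrix element of `M` between `ℰ(k₁)` and `ℰ(k₂)` is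
`(1/2π) ∫ ⟨ℰ(k₁), U(u h₁, v h₂) ℰ(k₂)⟩ F⁻¹φ(u, v) du dv`. -/
def IsWeylQuantization (h : 𝔥 × 𝔥) (φ : ℝ × ℝ → ℂ) (M : BFock 𝔥) : Prop :=
  ∀ k₁ k₂ : Cplx 𝔥,
    IsFourierPairing φ (fun u v => ⟪expVec k₁, weylExp (u • h.1) (v • h.2) k₂⟫_ℂ)
      ⟪expVec k₁, M (expVec k₂)⟫_ℂ

/-- The domain of `O_h`. -/
def domO (h : 𝔥 × 𝔥) : Set (ℝ × ℝ → ℂ) := {φ | ∃ M, IsWeylQuantization h φ M}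

open Classical in
/-- The operator `O_h(φ)` (and `0` if `φ` is not in the domain of `O_h`). -/
def opO (h : 𝔥 × 𝔥) (φ : ℝ × ℝ → ℂ) : BFock 𝔥 :=
  if hφ : φ ∈ domO h then hφ.choose else 0

/-- `∂φ/∂x`. -/
def dx (φ : ℝ × ℝ → ℂ) : ℝ × ℝ → ℂ := fun p => deriv (fun x : ℝ => φ (x, p.2)) p.1

/-- `∂φ/∂y`. -/
def dy (φ : ℝ × ℝ → ℂ) : ℝ × ℝ → ℂ := fun p => deriv (fun y : ℝ => φ (p.1, y)) p.2

/-- The smooth functions all of whose partial derivatives are in the domain of `O_h`. -/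
def smoothSymbols (h : 𝔥 × 𝔥) : Set (ℝ × ℝ → ℂ) :=
  {φ | ContDiff ℝ (⊤ : ℕ∞) φ ∧ ∀ a b : ℕ, dx^[a] (dy^[b] φ) ∈ domO h}

variable (𝔥) in
/-- The algebra `𝒮` of smooth functionals, generated by the operators `O_h(φ)`. -/
def smoothAlg : NonUnitalSubalgebra ℂ (BFock 𝔥) :=
  NonUnitalAlgebra.adjoin ℂ {M | ∃ h : 𝔥 × 𝔥, ∃ φ ∈ smoothSymbols h, M = opO h φ}

/-! ### The derivation operator -/

variable (𝔥) in
/-- The Hilbert space tensor product of the Fock space and `𝔥_ℂ ⊗ ℂ² = 𝔥_ℂ ⊕ 𝔥_ℂ`. -/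
abbrev FockTensor : Type u := HilbertTensor (Fock 𝔥) (WithLp 2 (Cplx 𝔥 × Cplx 𝔥))

variable (𝔥) in
/-- The Hilbert module of bounded operators from the Fock space to its tensor product with
`𝔥_ℂ ⊗ ℂ²`. -/
abbrev HModule : Type u := Fock 𝔥 →L[ℂ] FockTensor 𝔥

/-- The element `O ⊗ k : v ↦ O v ⊗ k` of the Hilbert module. -/
def elemTensor (O : BFock 𝔥) (k : Cplx 𝔥 × Cplx 𝔥) : HModule 𝔥 :=
  ((hTmul (Fock 𝔥) (WithLp 2 (Cplx 𝔥 × Cplx 𝔥))).flip (WithLp.toLp 2 k)).comp O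

/-- The left action of `O`, given by `O · (O₁ ⊗ k) = O O₁ ⊗ k`; the right action
`(O₁ ⊗ k) · O = O₁ O ⊗ k` is composition. -/
def leftAct (O : BFock 𝔥) (α : HModule 𝔥) : HModule 𝔥 :=
  (ampliation O).comp α

/-- The operator-valued inner product `⟨α, β⟩ = α* β`, for which
`⟨O₁ ⊗ h, O₂ ⊗ k⟩ = O₁* O₂ ⟨h, k⟩`. -/
def moduleInner (α β : HModule 𝔥) : BFock 𝔥 :=
  (ContinuousLinearMap.adjoint α).comp β

/-- The graph of the derivation `D` on `𝒮`: `D O_h(φ) = (O_h(∂φ/∂x) ⊗ h₁, O_h(∂φ/∂y) ⊗ h₂)`,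
extended linearly and by the Leibniz rule. -/
inductive DerivGraph : BFock 𝔥 → HModule 𝔥 → Prop
  | gen (h : 𝔥 × 𝔥) (φ : ℝ × ℝ → ℂ) (hφ : φ ∈ smoothSymbols h) :
      DerivGraph (opO h φ)
        (elemTensor (opO h (dx φ)) (Cplx.ofReal h.1, 0) +
          elemTensor (opO h (dy φ)) (0, Cplx.ofReal h.2))
  | add {A B : BFock 𝔥} {α β : HModule 𝔥} (hA : DerivGraph A α) (hB : DerivGraph B β) :
      DerivGraph (A + B) (α + β)
  | smul (c : ℂ) {A : BFock 𝔥} {α : HModule 𝔥} (hA : DerivGraph A α) : DerivGraph (c • A) (c • α)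
  | mul {A B : BFock 𝔥} {α β : HModule 𝔥} (hA : DerivGraph A α) (hB : DerivGraph B β) :
      DerivGraph (A * B) (leftAct A β + α.comp B)

/-- The relation `A ∈ Dom D` and `D A = α` for the closure of `D`: `(A, α)` is in the closure of the
graph of `D` on `𝒮` with respect to the weak operator topologies. -/
def IsGradient (A : BFock 𝔥) (α : HModule 𝔥) : Prop :=
  ((ContinuousLinearMapWOT.ofCLM A, ContinuousLinearMapWOT.ofCLM α) :
      (Fock 𝔥 →WOT[ℂ] Fock 𝔥) × (Fock 𝔥 →WOT[ℂ] FockTensor 𝔥)) ∈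
    closure {p | DerivGraph p.1.toCLM p.2.toCLM}

/-- The matrix elements of `D_k B = (i/2) [Q(k₁) - P(k₂), B]`. -/
def dirDerivMatrix (k : Cplx 𝔥 × Cplx 𝔥) (B : BFock 𝔥) (f g : Cplx 𝔥) : ℂ :=
  Complex.I / 2 *
    (⟪cofieldExp (bar₂ k) f, B (expVec g)⟫_ℂ - ⟪expVec f, B (cofieldExp k g)⟫_ℂ)

/-! ### Elementary vector fields `u = ∑ⱼ Fⱼ ⊗ h⁽ʲ⁾`, gradients and divergence -/

/-- The element `u = ∑ⱼ Fⱼ ⊗ h⁽ʲ⁾` of the Hilbert module. -/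
def elemField {n : ℕ} (F : Fin n → BFock 𝔥) (h : Fin n → Cplx 𝔥 × Cplx 𝔥) : HModule 𝔥 :=
  ∑ j, elemTensor (F j) (h j)

/-- The conjugate `ū = ∑ⱼ Fⱼ* ⊗ h̄⁽ʲ⁾`. -/
def elemFieldBar {n : ℕ} (F : Fin n → BFock 𝔥) (h : Fin n → Cplx 𝔥 × Cplx 𝔥) : HModule 𝔥 :=
  elemField (fun j => ContinuousLinearMap.adjoint (F j)) (fun j => bar₂ (h j))

/-- The right gradient `⟨ū, D O⟩` of `O`, where `ω = D O`. -/
def rightGrad {n : ℕ} (F : Fin n → BFock 𝔥) (h : Fin n → Cplx 𝔥 × Cplx 𝔥) (ω : HModule 𝔥) :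
    BFock 𝔥 :=
  moduleInner (elemFieldBar F h) ω

/-- The left gradient `⟨ω̄, u⟩ = ∑ⱼ ⟨ω̄, h⁽ʲ⁾⟩ Fⱼ = ∑ⱼ ⟨h̄⁽ʲ⁾, ω⟩ Fⱼ` of `O`, where `ω = D O`. -/
def leftGrad {n : ℕ} (ω : HModule 𝔥) (F : Fin n → BFock 𝔥) (h : Fin n → Cplx 𝔥 × Cplx 𝔥) :
    BFock 𝔥 :=
  ∑ j, moduleInner (elemTensor 1 (bar₂ (h j))) ω * F j

/-- The two-sided gradient `A (D⃗_u B) + (A D⃖_u) B`, where `α = D A` and `β = D B`. -/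
def twoSidedGrad {n : ℕ} (F : Fin n → BFock 𝔥) (h : Fin n → Cplx 𝔥 × Cplx 𝔥)
    (A : BFock 𝔥) (α : HModule 𝔥) (B : BFock 𝔥) (β : HModule 𝔥) : BFock 𝔥 :=
  A * rightGrad F h β + leftGrad α F h * B

/-- The matrix elements of `δ(u) = ½ ∑ⱼ {P(h⁽ʲ⁾₁) + Q(h⁽ʲ⁾₂), Fⱼ} - ∑ⱼ D_{h⁽ʲ⁾} Fⱼ`. -/
def divergenceMatrix {n : ℕ} (F : Fin n → BFock 𝔥) (h : Fin n → Cplx 𝔥 × Cplx 𝔥)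
    (f g : Cplx 𝔥) : ℂ :=
  1 / 2 * ∑ j, (⟪fieldExp (bar₂ (h j)) f, F j (expVec g)⟫_ℂ +
      ⟪expVec f, F j (fieldExp (h j) g)⟫_ℂ) -
    ∑ j, dirDerivMatrix (h j) (F j) f g

/-- `u = ∑ⱼ Fⱼ ⊗ h⁽ʲ⁾` is in the domain of the divergence: all `Fⱼ` are in `𝒮` and the expression
for `δ(u)` defines a bounded operator. -/
def MemDivergenceDomain {n : ℕ} (F : Fin n → BFock 𝔥) (h : Fin n → Cplx 𝔥 × Cplx 𝔥) : Prop :=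
  (∀ j, F j ∈ smoothAlg 𝔥) ∧ DefinesBounded (divergenceMatrix F h)

/-- The divergence `δ(u)` of `u = ∑ⱼ Fⱼ ⊗ h⁽ʲ⁾`. -/
def divergence {n : ℕ} (F : Fin n → BFock 𝔥) (h : Fin n → Cplx 𝔥 × Cplx 𝔥) : BFock 𝔥 :=
  boundedOf (divergenceMatrix F h)

/-- `A` commutes with `P(k₁) + Q(k₂)`: the commutator, as a form on exponential vectors, is `0`. -/
def CommutesWithField (A : BFock 𝔥) (k : Cplx 𝔥 × Cplx 𝔥) : Prop :=
  ∀ f g, ⟪fieldExp (bar₂ k) f, A (expVec g)⟫_ℂ = ⟪expVec f, A (fieldExp k g)⟫_ℂ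

end Fock

end QMalliavin

end

open QMalliavin

noncomputable section

namespace QMalliavin

universe u

open Filter Topology

variable {𝔥 : Type u} [NormedAddCommGroup 𝔥] [InnerProductSpace ℝ 𝔥]

/-! ### Exponential vectors -/

/-! On exponential vectors `P(k₁) + Q(k₂) = a(w') + a⁺(w)` and `i (Q(k₁) - P(k₂)) = a(w') - a⁺(w)`,
where `w' = k̄₂ - i k̄₁` and `w = k₂ - i k₁`. Hence `D_k F = ½ [a(w') - a⁺(w), F]`, and half the
anticommutator minus `D_k F` is the normally ordered expression `a⁺(w) F + F a(w')`. So `δ(u) = ∑ⱼ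
(a⁺(wⱼ) Fⱼ + Fⱼ a(w'ⱼ))` (`divergenceMatrix_eq`).

If `A` commutes with `a(w') + a⁺(w)`, then `[a(w'), A] = -[a⁺(w), A] = D_k A`. Since annihilation
operators kill `Ω`, this gives `a(w') B Ω = (D_k B) Ω` and `a(w) A* Ω = (D_k A)* Ω`. Inserting both
into `⟨A* Ω, δ(u) B Ω⟩` yields the sum over `j` of the expectations of `(D_k A) Fⱼ B + A Fⱼ (D_k B)`
with `k = h⁽ʲ⁾`, which is the claim once `D_k B = ⟨k̄, DB⟩` is known.

Two points need analysis. The vectors `A* Ω` and `B Ω` need not be combinations of exponential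
vectors, where the unbounded operators are under control. They are regularized by the second
quantization `S_t` of multiplication by `t < 1` (`secondQuant`), for which `a(c) S_t` is bounded
with norm at most `‖c‖ / √(1 - t)`, and `t → 1` (`vacuumState_mul_divergence_mul`). The same device
proves the Leibniz rule for `D_k` (`IsDirDeriv.mul`).

The identity `D_k B = ⟨k̄, DB⟩` is stable under sums, scalars, products and weak limits
(`IsGradient.isDirDeriv`), so only the generators `O_h(φ)` matter. The Wigner measure of a pair of
exponential vectors is a Gaussian on `ℝ²` with complex mean. Moving `(f, g)` in the direction
`(w'/2, w/2)` moves this mean by `(⟨k̄₁, h₁⟩, ⟨k̄₂, h₂⟩)`, and Gaussian integration by parts turns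
the shift into partial derivatives of `φ` (`isDirDeriv_opO`). -/

theorem inner_symPurePow (k l : Cplx 𝔥) (n : ℕ) :
    ⟪symPurePow k n, symPurePow l n⟫_ℂ = ⟪k, l⟫_ℂ ^ n := inner_purePow k l n

theorem expVec_apply (k : Cplx 𝔥) (n : ℕ) :
    (expVec k : Fock 𝔥) n = ((Real.sqrt n.factorial : ℝ) : ℂ)⁻¹ • symPurePow k n := rfl

theorem symPurePow_smul (c : ℂ) (k : Cplx 𝔥) (n : ℕ) :
    symPurePow (c • k) n = c ^ n • symPurePow k n := by
  apply Subtype.ext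
  change purePow (c • k) n = c ^ n • purePow k n
  induction n with
  | zero => simp [purePow]
  | succ n ih => simp only [purePow, ih, map_smul, _root_.smul_apply, smul_smul]; ring_nf

theorem sqrt_factorial_inv_mul_self (n : ℕ) :
    ((Real.sqrt n.factorial : ℝ) : ℂ)⁻¹ * ((Real.sqrt n.factorial : ℝ) : ℂ)⁻¹ =
      (n.factorial : ℂ)⁻¹ := by
  rw [← mul_inv, ← Complex.ofReal_mul, Real.mul_self_sqrt (by positivity)]
  simp

theorem inner_expVec (f g : Cplx 𝔥) :
    ⟪(expVec f : Fock 𝔥), expVec g⟫_ℂ = Complex.exp ⟪f, g⟫_ℂ := by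
  refine (lp.hasSum_inner (expVec f : Fock 𝔥) (expVec g)).unique ?_
  rw [Complex.exp_eq_exp_ℂ]
  refine (NormedSpace.exp_series_hasSum_exp' (𝕂 := ℂ) ⟪f, g⟫_ℂ).congr_fun fun n => ?_
  rw [expVec_apply, expVec_apply, inner_smul_left, inner_smul_right, inner_symPurePow, ← mul_assoc,
    map_inv₀, Complex.conj_ofReal, sqrt_factorial_inv_mul_self, smul_eq_mul]

/-- Scaling `k` by a real `t` turns the pairing into a power series in `t` whose coefficients are
the pairings level by level. The series vanishes identically, so every coefficient does, and the
vectors `k^{⊗ n}` span a dense subspace of each level. -/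
theorem eq_zero_of_inner_expVec (x : Fock 𝔥) (hx : ∀ k, ⟪expVec k, x⟫_ℂ = 0) : x = 0 := by
  have key : ∀ (k : Cplx 𝔥) (n : ℕ), ⟪symPurePow k n, x n⟫_ℂ = 0 := by
    intro k n
    let c : ℕ → ℂ := fun n => ⟪(expVec k : Fock 𝔥) n, x n⟫_ℂ
    let p : FormalMultilinearSeries ℝ ℝ ℂ := fun n => ContinuousMultilinearMap.mkPiRing ℝ (Fin n) (c n)
    have hp : HasFPowerSeriesAt 0 p (0 : ℝ) := by
      rw [hasFPowerSeriesAt_iff]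
      refine Eventually.of_forall fun t => ?_
      have h := lp.hasSum_inner (𝕜 := ℂ) (expVec ((t : ℂ) • k) : Fock 𝔥) x
      rw [hx] at h
      refine h.congr_fun fun n => ?_
      rw [expVec_apply, symPurePow_smul, smul_comm, inner_smul_left, ← expVec_apply]
      simp [p, c, FormalMultilinearSeries.coeff]
    have h0 : c n = 0 := by
      have h1 : p.coeff n = 0 := by rw [hp.eq_zero]; rfl
      simpa [p, FormalMultilinearSeries.coeff] using h1
    have h2 : (((Real.sqrt n.factorial : ℝ) : ℂ)⁻¹) ≠ 0 :=
      inv_ne_zero (by exact_mod_cast (Real.sqrt_pos.2 (by positivity)).ne')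
    have h3 : conj (((Real.sqrt n.factorial : ℝ) : ℂ)⁻¹) * ⟪symPurePow k n, x n⟫_ℂ = 0 := by
      rw [← inner_smul_left]; exact h0
    exact (mul_eq_zero.1 h3).resolve_left (by simpa using h2)
  apply lp.ext
  funext n
  have h1 : (x n : TensorPow (Cplx 𝔥) n) ∈ (symPow (Cplx 𝔥) n)ᗮ := by
    change _ ∈ (Submodule.topologicalClosure _)ᗮ
    rw [Submodule.orthogonal_closure, Submodule.mem_orthogonal]
    intro y hy
    induction hy using Submodule.span_induction with
    | mem y hy => obtain ⟨k, rfl⟩ := hy; exact key k n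
    | zero => simp
    | add y z _ _ hy hz => rw [inner_add_left, hy, hz, add_zero]
    | smul c y _ hy => rw [inner_smul_left, hy, mul_zero]
  exact Subtype.ext (inner_self_eq_zero.1
    ((Submodule.mem_orthogonal _ _).1 h1 (x n : TensorPow (Cplx 𝔥) n) (x n).2))

theorem ext_inner_expVec {x y : Fock 𝔥} (h : ∀ k, ⟪expVec k, x⟫_ℂ = ⟪expVec k, y⟫_ℂ) : x = y :=
  sub_eq_zero.1 (eq_zero_of_inner_expVec _ fun k => by rw [inner_sub_right, h, sub_self])

variable (𝔥) in
theorem dense_span_expVec :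
    Dense (Submodule.span ℂ (Set.range (expVec : Cplx 𝔥 → Fock 𝔥)) : Set (Fock 𝔥)) := by
  rw [Submodule.dense_iff_topologicalClosure_eq_top, Submodule.topologicalClosure_eq_top_iff,
    Submodule.eq_bot_iff]
  intro x hx
  exact eq_zero_of_inner_expVec x fun k =>
    (Submodule.mem_orthogonal _ _).1 hx _ (Submodule.subset_span ⟨k, rfl⟩)

theorem clm_ext_expVec {G : Type*} [NormedAddCommGroup G] [NormedSpace ℂ G]
    {S T : Fock 𝔥 →L[ℂ] G} (h : ∀ k, S (expVec k) = T (expVec k)) : S = T :=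
  ContinuousLinearMap.ext_on (dense_span_expVec 𝔥) (by rintro _ ⟨k, rfl⟩; exact h k)

/-- Operators with the same matrix elements between exponential vectors are equal. -/
theorem ext_matrix {S T : BFock 𝔥}
    (h : ∀ f g, ⟪expVec f, S (expVec g)⟫_ℂ = ⟪expVec f, T (expVec g)⟫_ℂ) : S = T :=
  clm_ext_expVec fun g => ext_inner_expVec fun f => h f g

/-- A uniformly bounded family of operators that converges on exponential vectors converges
pointwise. -/
theorem tendsto_of_tendsto_expVec {G ι : Type*} [NormedAddCommGroup G] [NormedSpace ℂ G]
    {l : Filter ι} (T : ι → Fock 𝔥 →L[ℂ] G) (T₀ : Fock 𝔥 →L[ℂ] G) (C : ℝ)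
    (hC : ∀ᶠ i in l, ‖T i‖ ≤ C)
    (h : ∀ k, Tendsto (fun i => T i (expVec k)) l (𝓝 (T₀ (expVec k)))) (x : Fock 𝔥) :
    Tendsto (fun i => T i x) l (𝓝 (T₀ x)) := by
  have hspan : ∀ y ∈ Submodule.span ℂ (Set.range (expVec : Cplx 𝔥 → Fock 𝔥)),
      Tendsto (fun i => T i y) l (𝓝 (T₀ y)) := by
    intro y hy
    induction hy using Submodule.span_induction with
    | mem y hy => obtain ⟨k, rfl⟩ := hy; exact h k
    | zero => simpa using tendsto_const_nhds
    | add y z _ _ hy hz => simpa using hy.add hz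
    | smul c y _ hy => simpa using hy.const_smul c
  rw [Metric.tendsto_nhds]
  intro ε hε
  -- The summand 1 only makes `K` positive, so that the radius `ε / (2K)` makes sense.
  set K : ℝ := |C| + ‖T₀‖ + 1
  have hK : 0 < K := by positivity
  obtain ⟨y, hy, hxy⟩ := Metric.dense_iff.1 (dense_span_expVec 𝔥) x (ε / (2 * K)) (by positivity)
  rw [Metric.mem_ball, dist_comm, dist_eq_norm] at hy
  filter_upwards [hC, Metric.tendsto_nhds.1 (hspan y hxy) (ε / 2) (by positivity)] with i h1 h2
  rw [dist_eq_norm] at h2 ⊢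
  have e : T i x - T₀ x = T i (x - y) - T₀ (x - y) + (T i y - T₀ y) := by
    simp only [map_sub]; abel
  have h3 : ‖T i (x - y)‖ ≤ |C| * ‖x - y‖ :=
    ((T i).le_opNorm _).trans (by gcongr; exact h1.trans (le_abs_self C))
  have h4 : (|C| + ‖T₀‖) * ‖x - y‖ ≤ ε / 2 := by
    have : K * ‖x - y‖ ≤ K * (ε / (2 * K)) := by gcongr
    rw [show K * (ε / (2 * K)) = ε / 2 by field_simp] at this
    refine le_trans ?_ this
    gcongr
    simp [K]
  calc ‖T i x - T₀ x‖ ≤ ‖T i (x - y)‖ + ‖T₀ (x - y)‖ + ‖T i y - T₀ y‖ := by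
        rw [e]; exact (norm_add_le _ _).trans (by gcongr; exact norm_sub_le _ _)
    _ ≤ |C| * ‖x - y‖ + ‖T₀‖ * ‖x - y‖ + ‖T i y - T₀ y‖ := by
        gcongr; exact T₀.le_opNorm _
    _ < ε := by rw [← add_mul]; linarith

/-! ### Creation and annihilation on exponential vectors -/

/-- The vector `a⁺(d) ℰ(f)`. -/
def creationExp (d f : Cplx 𝔥) : Fock 𝔥 := creation d ⟨expVec f, expVec_mem_creation d f⟩

theorem annihilation_expVec (c f : Cplx 𝔥) :
    annihilation c ⟨expVec f, expVec_mem_annihilation c f⟩ = ⟪c, f⟫_ℂ • (expVec f : Fock 𝔥) :=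
  lp.ext (annihilateSeq_expVec c f)

/-- The level-0 component of `a⁺(d) ℰ(f)` is zero. At the other levels creation is the adjoint of
annihilation, which acts on `ℰ(g)` by a scalar, so the series is a shifted multiple of the one for
`⟨ℰ(g), ℰ(f)⟩`. -/
theorem inner_expVec_creationExp (d f g : Cplx 𝔥) :
    ⟪expVec g, creationExp d f⟫_ℂ = ⟪g, d⟫_ℂ * Complex.exp ⟪g, f⟫_ℂ := by
  refine (lp.hasSum_inner (expVec g : Fock 𝔥) (creationExp d f)).unique ?_
  rw [← hasSum_nat_add_iff' 1]
  have h := (lp.hasSum_inner (expVec g : Fock 𝔥) (expVec f)).mul_left ⟪g, d⟫_ℂ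
  rw [inner_expVec] at h
  have h0 : (creationExp d f : Fock 𝔥) 0 = 0 := rfl
  simp only [Finset.range_one, Finset.sum_singleton, h0, inner_zero_right, sub_zero]
  refine h.congr_fun fun n => ?_
  have h1 : annihilateLevel d n ((expVec g : Fock 𝔥) (n + 1)) =
      ⟪d, g⟫_ℂ • (expVec g : Fock 𝔥) n := congrFun (annihilateSeq_expVec d g) n
  change ⟪(expVec g : Fock 𝔥) (n + 1), createLevel d n ((expVec f : Fock 𝔥) n)⟫_ℂ = _
  rw [← ContinuousLinearMap.adjoint_inner_left]
  change ⟪annihilateLevel d n ((expVec g : Fock 𝔥) (n + 1)), (expVec f : Fock 𝔥) n⟫_ℂ = _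
  rw [h1, inner_smul_left, inner_conj_symm]

/-- The annihilation part `k̄₂ - i k̄₁` of `P(k₁) + Q(k₂)`. -/
def annPart (k : Cplx 𝔥 × Cplx 𝔥) : Cplx 𝔥 := k.2.bar - Complex.I • k.1.bar

/-- The creation part `k₂ - i k₁` of `P(k₁) + Q(k₂)`. -/
def crePart (k : Cplx 𝔥 × Cplx 𝔥) : Cplx 𝔥 := k.2 - Complex.I • k.1

theorem bar_bar (k : Cplx 𝔥) : k.bar.bar = k := by
  ext <;> simp [Cplx.bar]

theorem annPart_bar₂ (k : Cplx 𝔥 × Cplx 𝔥) : annPart (bar₂ k) = crePart k := by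
  simp [annPart, crePart, bar₂, bar_bar]

theorem crePart_bar₂ (k : Cplx 𝔥 × Cplx 𝔥) : crePart (bar₂ k) = annPart k := rfl

theorem fieldExp_eq (k : Cplx 𝔥 × Cplx 𝔥) (f : Cplx 𝔥) :
    fieldExp k f = ⟪annPart k, f⟫_ℂ • expVec f + creationExp (crePart k) f := by
  refine ext_inner_expVec fun g => ?_
  change ⟪expVec g, Complex.I • (annihilation k.1.bar ⟨expVec f, expVec_mem_annihilation _ f⟩ -
    creationExp k.1 f) + (annihilation k.2.bar ⟨expVec f, expVec_mem_annihilation _ f⟩ +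
    creationExp k.2 f)⟫_ℂ = _
  rw [annihilation_expVec, annihilation_expVec]
  simp only [inner_add_right, inner_sub_right, inner_smul_right, inner_expVec_creationExp, annPart,
    crePart, inner_sub_left, inner_smul_left, inner_expVec, Complex.conj_I]
  ring

/-- The factor `i` is the one in the definition of `D_k`. With it, the conjugate field has the same
annihilation and creation parts as the field itself, with a relative minus sign. -/
theorem cofieldExp_eq (k : Cplx 𝔥 × Cplx 𝔥) (f : Cplx 𝔥) :
    Complex.I • cofieldExp k f = ⟪annPart k, f⟫_ℂ • expVec f - creationExp (crePart k) f := by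
  refine ext_inner_expVec fun g => ?_
  change ⟪expVec g, Complex.I • ((annihilation k.1.bar ⟨expVec f, expVec_mem_annihilation _ f⟩ +
    creationExp k.1 f) - Complex.I • (annihilation k.2.bar ⟨expVec f, expVec_mem_annihilation _ f⟩ -
    creationExp k.2 f))⟫_ℂ = _
  rw [annihilation_expVec, annihilation_expVec]
  simp only [inner_add_right, inner_sub_right, inner_smul_right, inner_expVec_creationExp, annPart,
    crePart, inner_sub_left, inner_smul_left, inner_expVec, Complex.conj_I]
  linear_combination (-Complex.exp ⟪g, f⟫_ℂ * (⟪k.2.bar, f⟫_ℂ - ⟪g, k.2⟫_ℂ)) * Complex.I_mul_I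

/-- The matrix elements of `[a(w') - a⁺(w), B]`, where `a(w') + a⁺(w) = P(k₁) + Q(k₂)`. -/
theorem two_mul_dirDerivMatrix (k : Cplx 𝔥 × Cplx 𝔥) (B : BFock 𝔥) (f g : Cplx 𝔥) :
    2 * dirDerivMatrix k B f g =
      ⟪creationExp (annPart k) f, B (expVec g)⟫_ℂ - ⟪f, crePart k⟫_ℂ * ⟪expVec f, B (expVec g)⟫_ℂ -
      ⟪annPart k, g⟫_ℂ * ⟪expVec f, B (expVec g)⟫_ℂ +
      ⟪expVec f, B (creationExp (crePart k) g)⟫_ℂ := by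
  have h1 := cofieldExp_eq (bar₂ k) f
  have h2 := cofieldExp_eq k g
  rw [annPart_bar₂, crePart_bar₂] at h1
  have h3 : ⟪Complex.I • cofieldExp (bar₂ k) f, B (expVec g)⟫_ℂ =
    -Complex.I * ⟪cofieldExp (bar₂ k) f, B (expVec g)⟫_ℂ := by
    rw [inner_smul_left, Complex.conj_I]
  have h4 : ⟪expVec f, B (Complex.I • cofieldExp k g)⟫_ℂ =
    Complex.I * ⟪expVec f, B (cofieldExp k g)⟫_ℂ := by
    rw [map_smul, inner_smul_right]
  rw [h1, inner_sub_left, inner_smul_left, inner_conj_symm] at h3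
  rw [h2, map_sub, map_smul, inner_sub_right, inner_smul_right] at h4
  rw [dirDerivMatrix]
  linear_combination h3 + h4

/-- Commutation with `a(w') + a⁺(w)`, written out so that it can be added to or subtracted from the
matrix elements of `[a(w') - a⁺(w), A]`. -/
theorem CommutesWithField.matrix_eq {A : BFock 𝔥} {k : Cplx 𝔥 × Cplx 𝔥}
    (hA : CommutesWithField A k) (f g : Cplx 𝔥) :
    ⟪creationExp (annPart k) f, A (expVec g)⟫_ℂ + ⟪f, crePart k⟫_ℂ * ⟪expVec f, A (expVec g)⟫_ℂ =
      ⟪annPart k, g⟫_ℂ * ⟪expVec f, A (expVec g)⟫_ℂ +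
      ⟪expVec f, A (creationExp (crePart k) g)⟫_ℂ := by
  have h := hA f g
  rw [fieldExp_eq, fieldExp_eq, annPart_bar₂, crePart_bar₂, inner_add_left, inner_smul_left,
    inner_conj_symm, map_add, map_smul, inner_add_right, inner_smul_right] at h
  rw [add_comm, h]

/-- The terms `a(w') F` and `F a⁺(w)` cancel between the anticommutator and the commutator. What
remains, `a⁺(w) F + F a(w')`, acts on exponential vectors by scalars on both sides. -/
theorem divergenceMatrix_eq {n : ℕ} (F : Fin n → BFock 𝔥) (h : Fin n → Cplx 𝔥 × Cplx 𝔥)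
    (f g : Cplx 𝔥) : divergenceMatrix F h f g =
      ∑ j, (⟪f, crePart (h j)⟫_ℂ + ⟪annPart (h j), g⟫_ℂ) * ⟪expVec f, F j (expVec g)⟫_ℂ := by
  rw [divergenceMatrix, Finset.mul_sum, ← Finset.sum_sub_distrib]
  refine Finset.sum_congr rfl fun j _ => ?_
  have h1 := two_mul_dirDerivMatrix (h j) (F j) f g
  rw [fieldExp_eq, fieldExp_eq, annPart_bar₂, crePart_bar₂, inner_add_left, inner_smul_left,
    inner_conj_symm, map_add, map_smul, inner_add_right, inner_smul_right]
  linear_combination -h1 / 2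

/-! ### Differentiability of the exponential vectors -/

theorem norm_expVec_sub_sq (f g : Cplx 𝔥) : ‖(expVec f - expVec g : Fock 𝔥)‖ ^ 2 =
    (Complex.exp ⟪f, f⟫_ℂ - Complex.exp ⟪f, g⟫_ℂ - Complex.exp ⟪g, f⟫_ℂ + Complex.exp ⟪g, g⟫_ℂ).re := by
  rw [← inner_self_eq_norm_sq (𝕜 := ℂ)]
  simp only [inner_sub_left, inner_sub_right, inner_expVec]
  simp; ring

/-- The difference quotients of exponential vectors are bounded. -/
theorem exists_norm_expVec_add_smul_sub_le (g d : Cplx 𝔥) :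
    ∃ C : ℝ, ∀ᶠ s : ℝ in 𝓝 0, ‖(expVec (g + (s : ℂ) • d) - expVec g : Fock 𝔥)‖ ≤ C * |s| := by
  set z : ℂ := ⟪g, d⟫_ℂ
  set D : ℂ := ⟪d, d⟫_ℂ
  set G : ℂ := ⟪g, g⟫_ℂ
  -- The three exponents below are at most `2 |s| (‖z‖ + ‖D‖ + 1)` in norm; `K s²` is the square of
  -- this bound and controls `exp w - 1 - w`.
  set K : ℝ := 4 * (‖z‖ + ‖D‖ + 1) ^ 2
  have hz : ⟪d, g⟫_ℂ = conj z := (inner_conj_symm _ _).symm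
  refine ⟨Real.sqrt (‖Complex.exp G‖ * (3 * K + ‖D‖)), ?_⟩
  have hK : 0 ≤ K := by positivity
  have hsmall : ∀ᶠ s : ℝ in 𝓝 0, |s| * (2 * (‖z‖ + ‖D‖ + 1)) < 1 := by
    have : Tendsto (fun s : ℝ => |s| * (2 * (‖z‖ + ‖D‖ + 1))) (𝓝 0) (𝓝 (|0| * (2 * (‖z‖ + ‖D‖ + 1)))) :=
      (continuous_abs.tendsto 0).mul_const _
    rw [abs_zero, zero_mul] at this
    exact this.eventually_lt_const one_pos
  filter_upwards [hsmall] with s hs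
  have hs1 : |s| ≤ 1 := by
    by_contra hcon
    push Not at hcon
    nlinarith [norm_nonneg z, norm_nonneg D]
  have hexp : ∀ w : ℂ, ‖w‖ ≤ |s| * (2 * (‖z‖ + ‖D‖ + 1)) →
      ‖Complex.exp w - 1 - w‖ ≤ K * s ^ 2 := by
    intro w hw
    refine (Complex.norm_exp_sub_one_sub_id_le (hw.trans hs.le)).trans ?_
    refine (pow_le_pow_left₀ (norm_nonneg _) hw 2).trans (le_of_eq ?_)
    rw [mul_pow, sq_abs]; simp only [K]; ring
  have b1 : ‖(s : ℂ) * z‖ ≤ |s| * (2 * (‖z‖ + ‖D‖ + 1)) := by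
    rw [norm_mul, Complex.norm_real, Real.norm_eq_abs]
    gcongr
    linarith [norm_nonneg z, norm_nonneg D]
  have b2 : ‖(s : ℂ) * conj z‖ ≤ |s| * (2 * (‖z‖ + ‖D‖ + 1)) := by
    rw [norm_mul, RCLike.norm_conj, ← norm_mul]; exact b1
  have b3 : ‖(s : ℂ) * z + (s : ℂ) * conj z + (s : ℂ) ^ 2 * D‖ ≤ |s| * (2 * (‖z‖ + ‖D‖ + 1)) := by
    refine (norm_add₃_le).trans ?_
    rw [norm_mul, norm_mul, norm_mul, norm_pow, RCLike.norm_conj, Complex.norm_real,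
      Real.norm_eq_abs]
    have : |s| ^ 2 * ‖D‖ ≤ |s| * ‖D‖ := by
      gcongr
      nlinarith [abs_nonneg s]
    nlinarith [abs_nonneg s, norm_nonneg z, norm_nonneg D, mul_nonneg (abs_nonneg s) (norm_nonneg D)]
  have e1 := hexp _ b1
  have e2 := hexp _ b2
  have e3 := hexp _ b3
  have key : ‖(expVec (g + (s : ℂ) • d) - expVec g : Fock 𝔥)‖ ^ 2 ≤
      ‖Complex.exp G‖ * (3 * K + ‖D‖) * s ^ 2 := by
    rw [norm_expVec_sub_sq]
    refine (Complex.re_le_norm _).trans ?_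
    -- The terms of first order in `s` cancel in this second difference of the kernel: only three
    -- quadratic remainders and `s² D` are left.
    have e : Complex.exp ⟪g + (s : ℂ) • d, g + (s : ℂ) • d⟫_ℂ - Complex.exp ⟪g + (s : ℂ) • d, g⟫_ℂ -
        Complex.exp ⟪g, g + (s : ℂ) • d⟫_ℂ + Complex.exp ⟪g, g⟫_ℂ =
        Complex.exp G * ((Complex.exp ((s : ℂ) * z + (s : ℂ) * conj z + (s : ℂ) ^ 2 * D) - 1 -
          ((s : ℂ) * z + (s : ℂ) * conj z + (s : ℂ) ^ 2 * D)) -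
          (Complex.exp ((s : ℂ) * conj z) - 1 - (s : ℂ) * conj z) -
          (Complex.exp ((s : ℂ) * z) - 1 - (s : ℂ) * z) + (s : ℂ) ^ 2 * D) := by
      simp only [inner_add_left, inner_add_right, inner_smul_left, inner_smul_right,
        Complex.conj_ofReal, hz]
      rw [show ⟪g, g⟫_ℂ = G from rfl, show ⟪g, d⟫_ℂ = z from rfl, show ⟪d, d⟫_ℂ = D from rfl,
        show G + (s : ℂ) * conj z + (s : ℂ) * (z + (s : ℂ) * D) =
          G + ((s : ℂ) * z + (s : ℂ) * conj z + (s : ℂ) ^ 2 * D) by ring,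
        Complex.exp_add G, Complex.exp_add G, Complex.exp_add G]
      ring
    rw [e, norm_mul, mul_assoc]
    gcongr
    refine (norm_add_le _ _).trans ?_
    have e4 : ‖(s : ℂ) ^ 2 * D‖ = ‖D‖ * s ^ 2 := by
      rw [norm_mul, norm_pow, Complex.norm_real, Real.norm_eq_abs, sq_abs, mul_comm]
    rw [e4]
    refine (add_le_add_left ((norm_sub_le _ _).trans
      (add_le_add_left (norm_sub_le _ _) _)) _).trans ?_
    linarith
  refine abs_le_of_sq_le_sq' ?_ (by positivity) |>.2
  rw [mul_pow, Real.sq_sqrt (by positivity), sq_abs]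
  exact key

theorem tendsto_expVec_add_smul (g d : Cplx 𝔥) :
    Tendsto (fun s : ℝ => (expVec (g + (s : ℂ) • d) : Fock 𝔥)) (𝓝 0) (𝓝 (expVec g)) := by
  obtain ⟨C, hC⟩ := exists_norm_expVec_add_smul_sub_le g d
  rw [tendsto_iff_norm_sub_tendsto_zero]
  refine squeeze_zero' (Eventually.of_forall fun _ => norm_nonneg _) hC ?_
  have : Tendsto (fun s : ℝ => C * |s|) (𝓝 0) (𝓝 (C * |0|)) :=
    (continuous_abs.tendsto 0).const_mul C
  simpa using this

/-- `a⁺(d) ℰ(g)` is the weak derivative of `s ↦ ℰ(g + s d)`. -/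
theorem tendsto_inner_expVec_quotient (g d : Cplx 𝔥) (x : Fock 𝔥) :
    Tendsto (fun s : ℝ => ⟪x, ((s : ℂ)⁻¹) • (expVec (g + (s : ℂ) • d) - expVec g : Fock 𝔥)⟫_ℂ)
      (𝓝[≠] 0) (𝓝 ⟪x, creationExp d g⟫_ℂ) := by
  obtain ⟨C, hC⟩ := exists_norm_expVec_add_smul_sub_le g d
  -- The difference quotients are bounded, so it suffices to test weak convergence on exponential
  -- vectors, where it is the derivative of a scalar exponential. Conjugations appear because the
  -- quotient sits in the antilinear slot.
  have h := tendsto_of_tendsto_expVec (l := 𝓝[≠] (0 : ℝ))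
    (fun s : ℝ => innerSL ℂ (((s : ℂ)⁻¹) • (expVec (g + (s : ℂ) • d) - expVec g : Fock 𝔥)))
    (innerSL ℂ (creationExp d g)) C ?_ ?_ x
  · have h' := (Complex.continuous_conj.tendsto _).comp h
    simpa only [Function.comp_def, innerSL_apply_apply, inner_conj_symm] using h'
  · filter_upwards [hC.filter_mono nhdsWithin_le_nhds, self_mem_nhdsWithin] with s hs hs0
    rw [innerSL_apply_norm, norm_smul, norm_inv, Complex.norm_real, Real.norm_eq_abs]
    have : 0 < |s| := abs_pos.2 hs0
    rw [inv_mul_le_iff₀ this, mul_comm]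
    exact hs
  · intro k
    have h1 : HasDerivAt (fun s : ℝ => Complex.exp (⟪k, g⟫_ℂ + (s : ℂ) * ⟪k, d⟫_ℂ))
        (⟪k, d⟫_ℂ * Complex.exp ⟪k, g⟫_ℂ) 0 := by
      have h2 : HasDerivAt (fun s : ℝ => ⟪k, g⟫_ℂ + (s : ℂ) * ⟪k, d⟫_ℂ) (⟪k, d⟫_ℂ) 0 := by
        simpa using ((Complex.ofRealCLM.hasDerivAt (x := (0 : ℝ))).mul_const ⟪k, d⟫_ℂ).const_add ⟪k, g⟫_ℂ
      have h3 := h2.cexp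
      simpa [mul_comm] using h3
    have h4 := (Complex.continuous_conj.tendsto _).comp h1.tendsto_slope_zero
    have h5 : (innerSL ℂ (creationExp d g)) (expVec k) =
        conj (⟪k, d⟫_ℂ * Complex.exp ⟪k, g⟫_ℂ) := by
      rw [innerSL_apply_apply, ← inner_expVec_creationExp, inner_conj_symm]
    rw [h5]
    refine h4.congr fun s => ?_
    rw [Function.comp_apply, innerSL_apply_apply, ← inner_conj_symm (_ • _)]
    congr 1
    rw [inner_smul_right, inner_sub_right, inner_expVec, inner_expVec, inner_add_right,
      inner_smul_right]
    simp

/-- The derivative of the matrix elements along a line of exponential vectors. -/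
theorem hasDerivAt_matrix (B : BFock 𝔥) (f g c d : Cplx 𝔥) :
    HasDerivAt (fun s : ℝ => ⟪expVec (f + (s : ℂ) • c), B (expVec (g + (s : ℂ) • d))⟫_ℂ)
      (⟪creationExp c f, B (expVec g)⟫_ℂ + ⟪expVec f, B (creationExp d g)⟫_ℂ) 0 := by
  rw [hasDerivAt_iff_tendsto_slope_zero]
  obtain ⟨C, hC⟩ := exists_norm_expVec_add_smul_sub_le g d
  have h1 : Tendsto (fun s : ℝ => ⟪((s : ℂ)⁻¹) • (expVec (f + (s : ℂ) • c) - expVec f : Fock 𝔥),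
      B (expVec g)⟫_ℂ) (𝓝[≠] 0) (𝓝 ⟪creationExp c f, B (expVec g)⟫_ℂ) := by
    have h' := (Complex.continuous_conj.tendsto _).comp
      (tendsto_inner_expVec_quotient f c (B (expVec g)))
    simpa only [Function.comp_def, inner_conj_symm] using h'
  have h2 : Tendsto (fun s : ℝ => ⟪expVec f, B (((s : ℂ)⁻¹) •
      (expVec (g + (s : ℂ) • d) - expVec g : Fock 𝔥))⟫_ℂ) (𝓝[≠] 0)
      (𝓝 ⟪expVec f, B (creationExp d g)⟫_ℂ) := by
    simpa only [ContinuousLinearMap.adjoint_inner_left] using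
      tendsto_inner_expVec_quotient g d (ContinuousLinearMap.adjoint B (expVec f))
  -- The cross term of the product rule: one factor tends to 0 in norm while the quotient stays
  -- bounded, so weak differentiability of the two sides is enough.
  have h3 : Tendsto (fun s : ℝ => ⟪(expVec (f + (s : ℂ) • c) - expVec f : Fock 𝔥),
      B (((s : ℂ)⁻¹) • (expVec (g + (s : ℂ) • d) - expVec g : Fock 𝔥))⟫_ℂ) (𝓝[≠] 0) (𝓝 0) := by
    have h4 : Tendsto (fun s : ℝ => ‖(expVec (f + (s : ℂ) • c) - expVec f : Fock 𝔥)‖ * (‖B‖ * C))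
        (𝓝[≠] 0) (𝓝 0) := by
      have := ((tendsto_iff_norm_sub_tendsto_zero.1 (tendsto_expVec_add_smul f c)).mono_left
        (nhdsWithin_le_nhds (s := {0}ᶜ))).mul_const (‖B‖ * C)
      simpa using this
    refine squeeze_zero_norm' ?_ h4
    filter_upwards [hC.filter_mono nhdsWithin_le_nhds, self_mem_nhdsWithin] with s hs hs0
    refine (norm_inner_le_norm _ _).trans ?_
    gcongr
    refine (B.le_opNorm _).trans ?_
    gcongr
    rw [norm_smul, norm_inv, Complex.norm_real, Real.norm_eq_abs,
      inv_mul_le_iff₀ (abs_pos.2 hs0), mul_comm]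
    exact hs
  have h5 := (h1.add h2).add h3
  rw [add_zero] at h5
  refine h5.congr fun s => ?_
  simp only [inner_smul_left, inner_smul_right, map_smul, inner_sub_left, inner_sub_right, map_sub,
    map_inv₀, Complex.conj_ofReal, Complex.ofReal_zero, zero_smul, add_zero, zero_add,
    Complex.real_smul, Complex.ofReal_inv]
  ring

/-! ### Second quantization of contractions -/

/-- The bounded operator `x ↦ (Lₙ xₙ₊ⱼ)ₙ`. -/
def levelOp (j : ℕ) (L : ∀ n, symPow (Cplx 𝔥) (n + j) →L[ℂ] symPow (Cplx 𝔥) n) (K : ℝ)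
    (hL : ∀ n, ‖L n‖ ≤ K) : BFock 𝔥 :=
  have hK : 0 ≤ K := (ContinuousLinearMap.opNorm_nonneg _).trans (hL 0)
  have hsum : ∀ x : Fock 𝔥, Summable fun n => K ^ 2 * ‖x (n + j)‖ ^ 2 := fun x => by
    have h := (lp.memℓp x).summable (by norm_num)
    simp only [ENNReal.toReal_ofNat, Real.rpow_ofNat] at h
    exact ((summable_nat_add_iff j).2 h).mul_left _
  have hle : ∀ (x : Fock 𝔥) (n : ℕ), ‖L n (x (n + j))‖ ^ 2 ≤ K ^ 2 * ‖x (n + j)‖ ^ 2 := fun x n => by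
    rw [← mul_pow]
    gcongr
    exact (L n).le_of_opNorm_le (hL n) _
  have hmem : ∀ x : Fock 𝔥, Memℓp (E := fun n : ℕ => symPow (Cplx 𝔥) n)
      (fun n => L n (x (n + j))) 2 := fun x => by
    apply memℓp_gen
    simp only [ENNReal.toReal_ofNat, Real.rpow_ofNat]
    exact Summable.of_nonneg_of_le (fun n => by positivity) (hle x) (hsum x)
  LinearMap.mkContinuous
    { toFun := fun x => ⟨fun n => L n (x (n + j)), hmem x⟩
      map_add' := fun x y => lp.ext (funext fun n => map_add (L n) _ _)
      map_smul' := fun c x => lp.ext (funext fun n => map_smul (L n) c _) } K (fun x => by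
    refine abs_le_of_sq_le_sq' ?_ (by positivity) |>.2
    have h1 := lp.norm_rpow_eq_tsum (p := 2) (by norm_num)
      (⟨fun n => L n (x (n + j)), hmem x⟩ : Fock 𝔥)
    have h2 := lp.norm_rpow_eq_tsum (p := 2) (by norm_num) x
    have h3 := (lp.memℓp x).summable (by norm_num)
    simp only [ENNReal.toReal_ofNat, Real.rpow_ofNat] at h1 h2 h3
    rw [mul_pow, h2, ← tsum_mul_left]
    refine h1.le.trans ?_
    refine ((Summable.of_nonneg_of_le (fun n => by positivity) (hle x) (hsum x)).tsum_le_tsum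
      (hle x) (hsum x)).trans ?_
    -- The shift by `j` drops the first `j` levels, which only decreases the norm.
    rw [← (h3.mul_left (K ^ 2)).sum_add_tsum_nat_add j]
    exact le_add_of_nonneg_left (Finset.sum_nonneg fun _ _ => by positivity))

theorem levelOp_apply (j : ℕ) (L : ∀ n, symPow (Cplx 𝔥) (n + j) →L[ℂ] symPow (Cplx 𝔥) n) (K : ℝ)
    (hL : ∀ n, ‖L n‖ ≤ K) (x : Fock 𝔥) (n : ℕ) : levelOp j L K hL x n = L n (x (n + j)) := rfl

theorem norm_levelOp_le (j : ℕ) (L : ∀ n, symPow (Cplx 𝔥) (n + j) →L[ℂ] symPow (Cplx 𝔥) n) (K : ℝ)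
    (hL : ∀ n, ‖L n‖ ≤ K) : ‖levelOp j L K hL‖ ≤ K := by
  unfold levelOp
  exact LinearMap.mkContinuous_norm_le _ ((ContinuousLinearMap.opNorm_nonneg _).trans (hL 0)) _

theorem norm_annihilateLevel_le (c : Cplx 𝔥) (n : ℕ) :
    ‖annihilateLevel c n‖ ≤ Real.sqrt (n + 1) * ‖c‖ := by
  rw [annihilateLevel, LinearIsometryEquiv.norm_map]
  refine ContinuousLinearMap.opNorm_le_bound _ (by positivity) fun x => ?_
  rw [mul_assoc]
  exact createLevel_norm_le c n x

/-- After squaring, `(n + 1) t^(2(n+1))` is a sum of `n + 1` equal terms, each at most `t^i` for `i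
≤ n`, and the geometric series bounds the total by `1 / (1 - t)`. The exponent `1/2` of the blow-up
is what makes the errors at `t → 1` vanish. -/
theorem pow_succ_mul_sqrt_le (t : Set.Ioo (0 : ℝ) 1) (n : ℕ) :
    (t : ℝ) ^ (n + 1) * Real.sqrt (n + 1) ≤ (Real.sqrt (1 - t))⁻¹ := by
  obtain ⟨t, h0, h1⟩ := t
  have h2 : 0 < 1 - t := sub_pos.2 h1
  simp only
  rw [← Real.sqrt_inv]
  refine Real.le_sqrt_of_sq_le ?_
  rw [mul_pow, Real.sq_sqrt (by positivity), ← pow_mul]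
  have h3 : ∑ i ∈ Finset.range (n + 1), t ^ ((n + 1) * 2) ≤ ∑ i ∈ Finset.range (n + 1), t ^ i := by
    refine Finset.sum_le_sum fun i hi => pow_le_pow_of_le_one h0.le h1.le ?_
    have := Finset.mem_range.1 hi
    omega
  have h4 : ∑ i ∈ Finset.range (n + 1), t ^ i ≤ (1 - t)⁻¹ := by
    rw [← tsum_geometric_of_lt_one h0.le h1]
    exact (summable_geometric_of_lt_one h0.le h1).sum_le_tsum _ (fun i _ => by positivity)
  simp only [Finset.sum_const, Finset.card_range, nsmul_eq_mul] at h3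
  push_cast at h3
  linarith

/-- The second quantization of multiplication by `t`. -/
def secondQuant (t : Set.Ioo (0 : ℝ) 1) : BFock 𝔥 :=
  levelOp 0 (fun n => ((t : ℝ) : ℂ) ^ n • ContinuousLinearMap.id ℂ _) 1 fun n => by
    refine (ContinuousLinearMap.opNorm_smul_le _ _).trans ?_
    rw [norm_pow, Complex.norm_real, Real.norm_of_nonneg t.2.1.le]
    exact mul_le_one₀ (pow_le_one₀ t.2.1.le t.2.2.le) (ContinuousLinearMap.opNorm_nonneg _) ContinuousLinearMap.norm_id_le

/-- The bounded operator `a(c) S`, where `S` is the second quantization of multiplication by `t`. -/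
def annihilateQuant (c : Cplx 𝔥) (t : Set.Ioo (0 : ℝ) 1) : BFock 𝔥 :=
  levelOp 1 (fun n => ((t : ℝ) : ℂ) ^ (n + 1) • annihilateLevel c n)
    ((Real.sqrt (1 - t))⁻¹ * ‖c‖) fun n => by
    refine (ContinuousLinearMap.opNorm_smul_le _ _).trans ?_
    rw [norm_pow, Complex.norm_real, Real.norm_of_nonneg t.2.1.le]
    refine (mul_le_mul_of_nonneg_left (norm_annihilateLevel_le c n) (pow_nonneg t.2.1.le _)).trans ?_
    rw [← mul_assoc]
    exact mul_le_mul_of_nonneg_right (pow_succ_mul_sqrt_le t n) (norm_nonneg _)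

theorem norm_secondQuant_le (t : Set.Ioo (0 : ℝ) 1) : ‖(secondQuant t : BFock 𝔥)‖ ≤ 1 :=
  norm_levelOp_le _ _ _ _

theorem norm_annihilateQuant_le (c : Cplx 𝔥) (t : Set.Ioo (0 : ℝ) 1) :
    ‖annihilateQuant c t‖ ≤ (Real.sqrt (1 - t))⁻¹ * ‖c‖ :=
  norm_levelOp_le _ _ _ _

theorem secondQuant_expVec (t : Set.Ioo (0 : ℝ) 1) (f : Cplx 𝔥) :
    secondQuant t (expVec f) = expVec (((t : ℝ) : ℂ) • f) := by
  apply lp.ext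
  funext n
  rw [secondQuant, levelOp_apply, expVec_apply, expVec_apply, symPurePow_smul, smul_comm]
  rfl

theorem annihilateQuant_expVec (c : Cplx 𝔥) (t : Set.Ioo (0 : ℝ) 1) (f : Cplx 𝔥) :
    annihilateQuant c t (expVec f) = ⟪c, ((t : ℝ) : ℂ) • f⟫_ℂ • expVec (((t : ℝ) : ℂ) • f) := by
  apply lp.ext
  funext n
  have h1 : annihilateLevel c n ((expVec f : Fock 𝔥) (n + 1)) =
      ⟪c, f⟫_ℂ • (expVec f : Fock 𝔥) n := congrFun (annihilateSeq_expVec c f) n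
  rw [annihilateQuant, levelOp_apply]
  change ((t : ℝ) : ℂ) ^ (n + 1) • annihilateLevel c n ((expVec f : Fock 𝔥) (n + 1)) =
    ⟪c, ((t : ℝ) : ℂ) • f⟫_ℂ • (expVec (((t : ℝ) : ℂ) • f) : Fock 𝔥) n
  rw [h1, expVec_apply, expVec_apply, symPurePow_smul, inner_smul_right]
  simp only [smul_smul]
  congr 1
  ring

/-- This is `(a(c) S)* = S a⁺(c) = t a⁺(c) S`: moving a creation operator past the second
quantization costs a factor `t`. -/
theorem adjoint_annihilateQuant_expVec (c : Cplx 𝔥) (t : Set.Ioo (0 : ℝ) 1) (f : Cplx 𝔥) :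
    ContinuousLinearMap.adjoint (annihilateQuant c t) (expVec f) =
      ((t : ℝ) : ℂ) • creationExp c (((t : ℝ) : ℂ) • f) := by
  refine ext_inner_expVec fun g => ?_
  rw [ContinuousLinearMap.adjoint_inner_right, annihilateQuant_expVec, inner_smul_left,
    inner_smul_right (𝕜 := ℂ) (expVec g), inner_expVec_creationExp, inner_expVec, inner_conj_symm,
    inner_smul_left, inner_smul_left, inner_smul_right, Complex.conj_ofReal, mul_assoc]

theorem inner_secondQuant_left (t : Set.Ioo (0 : ℝ) 1) (x y : Fock 𝔥) :
    ⟪secondQuant t x, y⟫_ℂ = ⟪x, secondQuant t y⟫_ℂ := by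
  have h : ContinuousLinearMap.adjoint (secondQuant t) = (secondQuant t : BFock 𝔥) :=
    ext_matrix fun f g => by
      rw [ContinuousLinearMap.adjoint_inner_right, secondQuant_expVec, secondQuant_expVec,
        inner_expVec, inner_expVec, inner_smul_left, inner_smul_right, Complex.conj_ofReal]
  rw [← ContinuousLinearMap.adjoint_inner_right, h]

/-- The filter of parameters in `(0, 1)` tending to `1`. -/
def toOne : Filter (Set.Ioo (0 : ℝ) 1) := comap (fun t : Set.Ioo (0 : ℝ) 1 => (t : ℝ)) (𝓝 1)

theorem tendsto_toOne : Tendsto (fun t : Set.Ioo (0 : ℝ) 1 => (t : ℝ)) toOne (𝓝 1) := tendsto_comap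

instance : NeBot toOne := by
  refine comap_neBot_iff_frequently.2 ?_
  have h : (1 : ℝ) ∈ closure (Set.Ioo (0 : ℝ) 1) := by
    rw [closure_Ioo zero_ne_one]; exact ⟨zero_le_one, le_rfl⟩
  exact (mem_closure_iff_frequently.1 h).mono fun x hx => ⟨⟨x, hx⟩, rfl⟩

theorem tendsto_secondQuant (x : Fock 𝔥) :
    Tendsto (fun t : Set.Ioo (0 : ℝ) 1 => secondQuant t x) toOne (𝓝 x) := by
  refine tendsto_of_tendsto_expVec (fun t : Set.Ioo (0 : ℝ) 1 => (secondQuant t : BFock 𝔥)) 1 1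
    (Eventually.of_forall norm_secondQuant_le) (fun k => ?_) x
  -- `S ℰ(k) = ℰ(t k)` is written as `ℰ(k + (t - 1) k)`, so that continuity along a line applies.
  have h1 : Tendsto (fun t : Set.Ioo (0 : ℝ) 1 => (t : ℝ) - 1) toOne (𝓝 0) := by
    simpa using tendsto_toOne.sub_const 1
  refine ((tendsto_expVec_add_smul k k).comp h1).congr fun t => ?_
  rw [Function.comp_apply, secondQuant_expVec]
  congr 1
  push_cast
  module

/-- `(1 - t) a(c) S` tends to `0` in norm. -/
theorem tendsto_norm_mul_norm_annihilateQuant (c : Cplx 𝔥) :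
    Tendsto (fun t : Set.Ioo (0 : ℝ) 1 => ‖1 - ((t : ℝ) : ℂ)⁻¹‖ * ‖annihilateQuant c t‖) toOne
      (𝓝 0) := by
  have h1 : Tendsto (fun t : Set.Ioo (0 : ℝ) 1 => (t : ℝ)⁻¹ * Real.sqrt (1 - t) * ‖c‖) toOne
      (𝓝 ((1 : ℝ)⁻¹ * Real.sqrt (1 - 1) * ‖c‖)) :=
    ((tendsto_toOne.inv₀ one_ne_zero).mul (tendsto_toOne.const_sub 1).sqrt).mul_const _
  rw [sub_self, Real.sqrt_zero, mul_zero, zero_mul] at h1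
  refine squeeze_zero (fun t => by positivity) (fun t => ?_) h1
  obtain ⟨ht0, ht1⟩ := t.2
  have h2 : (0 : ℝ) < 1 - t := sub_pos.2 ht1
  have h3 : ‖(1 - ((t : ℝ) : ℂ)⁻¹)‖ = (t : ℝ)⁻¹ * (1 - t) := by
    have : (1 - ((t : ℝ) : ℂ)⁻¹) = ((-((t : ℝ)⁻¹ * (1 - t)) : ℝ) : ℂ) := by
      have : ((t : ℝ) : ℂ) ≠ 0 := by exact_mod_cast ht0.ne'
      push_cast
      field_simp
      ring
    rw [this, Complex.norm_real, norm_neg, Real.norm_of_nonneg (by positivity)]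
  rw [h3]
  refine (mul_le_mul_of_nonneg_left (norm_annihilateQuant_le c t) (by positivity)).trans
    (le_of_eq ?_)
  have h4 : (1 - (t : ℝ)) * (Real.sqrt (1 - t))⁻¹ = Real.sqrt (1 - t) := by
    rw [← div_eq_mul_inv, Real.div_sqrt]
  linear_combination ((t : ℝ)⁻¹ * ‖c‖) * h4

/-! ### The Hilbert module -/

theorem elemTensor_apply (O : BFock 𝔥) (k : Cplx 𝔥 × Cplx 𝔥) (x : Fock 𝔥) :
    elemTensor O k x = hTmul (Fock 𝔥) (WithLp 2 (Cplx 𝔥 × Cplx 𝔥)) (O x) (WithLp.toLp 2 k) := rfl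

/-- The component `⟨k̄, α⟩` of an element of the Hilbert module. -/
def gradComp (k : Cplx 𝔥 × Cplx 𝔥) (α : HModule 𝔥) : BFock 𝔥 :=
  moduleInner (elemTensor 1 (bar₂ k)) α

theorem inner_gradComp (k : Cplx 𝔥 × Cplx 𝔥) (α : HModule 𝔥) (x y : Fock 𝔥) :
    ⟪x, gradComp k α y⟫_ℂ = ⟪elemTensor 1 (bar₂ k) x, α y⟫_ℂ := by
  rw [gradComp, moduleInner, ContinuousLinearMap.comp_apply,
    ContinuousLinearMap.adjoint_inner_right]

theorem gradComp_add (k : Cplx 𝔥 × Cplx 𝔥) (α β : HModule 𝔥) :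
    gradComp k (α + β) = gradComp k α + gradComp k β :=
  ContinuousLinearMap.comp_add _ _ _

theorem gradComp_smul (k : Cplx 𝔥 × Cplx 𝔥) (c : ℂ) (α : HModule 𝔥) :
    gradComp k (c • α) = c • gradComp k α :=
  ContinuousLinearMap.comp_smul _ _ _

theorem gradComp_comp (k : Cplx 𝔥 × Cplx 𝔥) (α : HModule 𝔥) (B : BFock 𝔥) :
    gradComp k (α.comp B) = gradComp k α * B := rfl

theorem gradComp_elemTensor (k l : Cplx 𝔥 × Cplx 𝔥) (O : BFock 𝔥) :
    gradComp k (elemTensor O l) = (⟪k.1.bar, l.1⟫_ℂ + ⟪k.2.bar, l.2⟫_ℂ) • O := by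
  refine ContinuousLinearMap.ext fun y => ext_inner_left ℂ fun x => ?_
  rw [inner_gradComp, elemTensor_apply, elemTensor_apply, inner_hTmul, WithLp.prod_inner_apply,
    _root_.smul_apply, inner_smul_right, mul_comm]
  rfl

/-- Elementary tensors are total in the completed tensor product. -/
theorem HilbertTensor.induction_on {E F : Type u} [NormedAddCommGroup E] [InnerProductSpace ℂ E]
    [NormedAddCommGroup F] [InnerProductSpace ℂ F] {S T : HilbertTensor E F →L[ℂ] ℂ}
    (h : ∀ x y, S (hTmul E F x y) = T (hTmul E F x y)) (z : HilbertTensor E F) : S z = T z := by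
  refine Completion.induction_on z (isClosed_eq S.continuous T.continuous) fun a => ?_
  induction a using TensorProduct.induction_on with
  | zero =>
    rw [Completion.coe_zero]
    exact (map_zero S).trans (map_zero T).symm
  | tmul x y => exact h x y
  | add a b ha hb =>
    rw [Completion.coe_add]
    exact (map_add S _ _).trans ((congrArg₂ _ ha hb).trans (map_add T _ _).symm)

/-- `β y` is a general vector of the completed tensor product, so the two functionals applied to it
are compared on elementary tensors. Together with `gradComp_comp` this turns the Leibniz rule for
`D` into the one for its components. -/
theorem gradComp_leftAct (k : Cplx 𝔥 × Cplx 𝔥) (A : BFock 𝔥) (β : HModule 𝔥) :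
    gradComp k (leftAct A β) = A * gradComp k β := by
  refine ContinuousLinearMap.ext fun y => ext_inner_left ℂ fun x => ?_
  rw [inner_gradComp, mul_apply_eq_comp, ← ContinuousLinearMap.adjoint_inner_left A,
    inner_gradComp]
  refine HilbertTensor.induction_on
    (S := (innerSL ℂ (elemTensor 1 (bar₂ k) x)).comp (ampliation A))
    (T := innerSL ℂ (elemTensor 1 (bar₂ k) (ContinuousLinearMap.adjoint A x)))
    (fun u v => ?_) (β y)
  rw [ContinuousLinearMap.comp_apply, ampliation_hTmul, innerSL_apply_apply, innerSL_apply_apply,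
    elemTensor_apply, elemTensor_apply, inner_hTmul, inner_hTmul]
  simp only [one_apply_eq_self, ContinuousLinearMap.adjoint_inner_left]

theorem rightGrad_eq {n : ℕ} (F : Fin n → BFock 𝔥) (h : Fin n → Cplx 𝔥 × Cplx 𝔥) (ω : HModule 𝔥) :
    rightGrad F h ω = ∑ j, F j * gradComp (h j) ω := by
  refine ContinuousLinearMap.ext fun y => ext_inner_left ℂ fun x => ?_
  rw [rightGrad, moduleInner, ContinuousLinearMap.comp_apply,
    ContinuousLinearMap.adjoint_inner_right, elemFieldBar, elemField, sum_apply, sum_inner,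
    sum_apply, inner_sum]
  refine Finset.sum_congr rfl fun j _ => ?_
  rw [mul_apply_eq_comp, ← ContinuousLinearMap.adjoint_inner_left (F j), inner_gradComp]
  rfl

theorem leftGrad_eq {n : ℕ} (ω : HModule 𝔥) (F : Fin n → BFock 𝔥) (h : Fin n → Cplx 𝔥 × Cplx 𝔥) :
    leftGrad ω F h = ∑ j, gradComp (h j) ω * F j := rfl

/-! ### Directional derivatives -/

/-- The commutator `D_k B` defines the bounded operator `β`. -/
def IsDirDeriv (k : Cplx 𝔥 × Cplx 𝔥) (B β : BFock 𝔥) : Prop :=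
  HasMatrix β (dirDerivMatrix k B)

namespace IsDirDeriv

variable {k : Cplx 𝔥 × Cplx 𝔥} {A B α β : BFock 𝔥}

theorem add (hA : IsDirDeriv k A α) (hB : IsDirDeriv k B β) : IsDirDeriv k (A + B) (α + β) := by
  intro f g
  simp only [_root_.add_apply, inner_add_right, hA f g, hB f g, dirDerivMatrix]
  ring

theorem smul (c : ℂ) (hA : IsDirDeriv k A α) : IsDirDeriv k (c • A) (c • α) := by
  intro f g
  simp only [_root_.smul_apply, inner_smul_right, hA f g, dirDerivMatrix]
  ring

theorem two_mul_inner (hA : IsDirDeriv k A α) (f g : Cplx 𝔥) :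
    2 * ⟪expVec f, α (expVec g)⟫_ℂ =
      ⟪creationExp (annPart k) f, A (expVec g)⟫_ℂ - ⟪f, crePart k⟫_ℂ * ⟪expVec f, A (expVec g)⟫_ℂ -
      ⟪annPart k, g⟫_ℂ * ⟪expVec f, A (expVec g)⟫_ℂ +
      ⟪expVec f, A (creationExp (crePart k) g)⟫_ℂ := by
  rw [hA f g, two_mul_dirDerivMatrix]

/-- The commutator identity for `A` holds a priori only with exponential vectors on the right. After
inserting `S`, both sides are bounded functionals of `x`, so density extends it to all `x`. The
vector on the left is `(a(w') - a⁺(w))* ℰ(f)`, and the last bracket is `(a(w') - a⁺(w)) S x`. -/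
theorem inner_left (hA : IsDirDeriv k A α) (t : Set.Ioo (0 : ℝ) 1) (f : Cplx 𝔥) (x : Fock 𝔥) :
    2 * ⟪expVec f, α (secondQuant t x)⟫_ℂ =
      ⟪creationExp (annPart k) f - ⟪crePart k, f⟫_ℂ • expVec f, A (secondQuant t x)⟫_ℂ -
      ⟪expVec f, A (annihilateQuant (annPart k) t x - ((t : ℝ) : ℂ)⁻¹ •
        ContinuousLinearMap.adjoint (annihilateQuant (crePart k) t) x)⟫_ℂ := by
  have ht : ((t : ℝ) : ℂ) ≠ 0 := by exact_mod_cast t.2.1.ne'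
  have h : (2 : ℂ) • (innerSL ℂ (expVec f)).comp (α.comp (secondQuant t)) =
      (innerSL ℂ (creationExp (annPart k) f - ⟪crePart k, f⟫_ℂ • expVec f)).comp
        (A.comp (secondQuant t)) -
      (innerSL ℂ (expVec f)).comp (A.comp (annihilateQuant (annPart k) t - ((t : ℝ) : ℂ)⁻¹ •
        ContinuousLinearMap.adjoint (annihilateQuant (crePart k) t))) := by
    refine clm_ext_expVec fun g => ?_
    simp only [_root_.smul_apply, _root_.sub_apply, ContinuousLinearMap.comp_apply,
      innerSL_apply_apply, secondQuant_expVec, annihilateQuant_expVec,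
      adjoint_annihilateQuant_expVec, smul_smul, inv_mul_cancel₀ ht, one_smul, smul_eq_mul]
    rw [hA.two_mul_inner, map_sub, map_smul, inner_sub_left, inner_sub_right, inner_smul_left,
      inner_smul_right (expVec f), inner_conj_symm]
    ring
  exact DFunLike.congr_fun h x

/-- Both sides are `S (a(w') - a⁺(w)) B ℰ(g)`: on the left `S` is absorbed into bounded operators,
on the right the field is commuted through `B` onto `ℰ(g)`. -/
theorem apply_right (hB : IsDirDeriv k B β) (t : Set.Ioo (0 : ℝ) 1) (g : Cplx 𝔥) :
    ((t : ℝ) : ℂ)⁻¹ • annihilateQuant (annPart k) t (B (expVec g)) -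
      ContinuousLinearMap.adjoint (annihilateQuant (crePart k) t) (B (expVec g)) =
    secondQuant t ((2 : ℂ) • β (expVec g) + ⟪annPart k, g⟫_ℂ • B (expVec g) -
      B (creationExp (crePart k) g)) := by
  have ht : ((t : ℝ) : ℂ) ≠ 0 := by exact_mod_cast t.2.1.ne'
  refine ext_inner_expVec fun f => ?_
  have h1 := hB.two_mul_inner (((t : ℝ) : ℂ) • f) g
  rw [← inner_secondQuant_left, secondQuant_expVec, inner_sub_right, inner_smul_right,
    ← ContinuousLinearMap.adjoint_inner_left, adjoint_annihilateQuant_expVec, inner_smul_left,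
    Complex.conj_ofReal, inv_mul_cancel_left₀ ht, ContinuousLinearMap.adjoint_inner_right,
    annihilateQuant_expVec, inner_smul_left, inner_conj_symm, inner_sub_right, inner_add_right,
    inner_smul_right, inner_smul_right, h1]
  ring

/-- Formally `[X, AB] = A [X, B] + [X, A] B` with `X = a(w') - a⁺(w)`, but `X` would have to act on
`x = B ℰ(g)`. The regularizations `X S` and `S X` of `inner_left` and `apply_right` differ by an
error that vanishes as `t → 1`, and `y` is the value that `X x` takes in the limit. -/
theorem mul (hA : IsDirDeriv k A α) (hB : IsDirDeriv k B β) :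
    IsDirDeriv k (A * B) (A * β + α * B) := by
  intro f g
  let R₁ : Set.Ioo (0 : ℝ) 1 → BFock 𝔥 := annihilateQuant (annPart k)
  let R₂ : Set.Ioo (0 : ℝ) 1 → BFock 𝔥 := fun t =>
    ContinuousLinearMap.adjoint (annihilateQuant (crePart k) t)
  set p : Fock 𝔥 := creationExp (annPart k) f - ⟪crePart k, f⟫_ℂ • expVec f
  set x : Fock 𝔥 := B (expVec g)
  set y : Fock 𝔥 := (2 : ℂ) • β (expVec g) + ⟪annPart k, g⟫_ℂ • B (expVec g) -
    B (creationExp (crePart k) g)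
  have hS := tendsto_secondQuant x
  -- This is `X S x - S X x`, because `S a(w') = t⁻¹ R₁` and `a⁺(w) S = t⁻¹ R₂`. The factor `1 -
  -- t⁻¹` beats the growth of `R₁` and `R₂`.
  have herr : Tendsto (fun t : Set.Ioo (0 : ℝ) 1 => (1 - ((t : ℝ) : ℂ)⁻¹) • (R₁ t x + R₂ t x)) toOne
      (𝓝 0) := by
    have h := ((tendsto_norm_mul_norm_annihilateQuant (annPart k)).add
      (tendsto_norm_mul_norm_annihilateQuant (crePart k))).mul_const ‖x‖
    rw [add_zero, zero_mul] at h
    refine squeeze_zero_norm (fun t => ?_) h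
    rw [norm_smul, ← mul_add, mul_assoc]
    gcongr
    rw [add_mul]
    refine (norm_add_le _ _).trans (add_le_add ((R₁ t).le_opNorm x) ?_)
    refine ((R₂ t).le_opNorm x).trans (le_of_eq ?_)
    rw [LinearIsometryEquiv.norm_map]
  have hlim : Tendsto (fun t : Set.Ioo (0 : ℝ) 1 => R₁ t x - ((t : ℝ) : ℂ)⁻¹ • R₂ t x) toOne
      (𝓝 y) := by
    have h := (tendsto_secondQuant y).add herr
    rw [add_zero] at h
    refine h.congr fun t => ?_
    rw [← hB.apply_right t g]
    change ((t : ℝ) : ℂ)⁻¹ • R₁ t x - R₂ t x + (1 - ((t : ℝ) : ℂ)⁻¹) • (R₁ t x + R₂ t x) = _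
    module
  have hL : Tendsto (fun t : Set.Ioo (0 : ℝ) 1 => 2 * ⟪expVec f, α (secondQuant t x)⟫_ℂ) toOne
      (𝓝 (2 * ⟪expVec f, α x⟫_ℂ)) :=
    (tendsto_const_nhds.inner ((α.continuous.tendsto x).comp hS)).const_mul 2
  have hR : Tendsto (fun t : Set.Ioo (0 : ℝ) 1 => 2 * ⟪expVec f, α (secondQuant t x)⟫_ℂ) toOne
      (𝓝 (⟪p, A x⟫_ℂ - ⟪expVec f, A y⟫_ℂ)) := by
    refine ((tendsto_const_nhds.inner ((A.continuous.tendsto x).comp hS)).sub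
      (tendsto_const_nhds.inner ((A.continuous.tendsto y).comp hlim))).congr fun t => ?_
    exact (hA.inner_left t f x).symm
  have key := tendsto_nhds_unique hL hR
  have h2 := two_mul_dirDerivMatrix k (A * B) f g
  simp only [mul_apply_eq_comp, _root_.add_apply, inner_add_right] at h2 ⊢
  rw [inner_sub_left, inner_smul_left, inner_conj_symm, map_sub, map_add, map_smul, map_smul,
    inner_sub_right, inner_add_right, inner_smul_right, inner_smul_right] at key
  linear_combination (key - h2) / 2

variable (hA : IsDirDeriv k A α) (hAk : CommutesWithField A k)
include hA hAk

/-- Because `[a(w') + a⁺(w), A] = 0`, the half commutator `½ [a(w') - a⁺(w), A] = α` equals `[a(w'),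
A]`. The companion for `creationExp (crePart k) g` is `-[a⁺(w), A] = α`. -/
theorem inner_creationExp_left (f g : Cplx 𝔥) :
    ⟪creationExp (annPart k) f, A (expVec g)⟫_ℂ =
      ⟪annPart k, g⟫_ℂ * ⟪expVec f, A (expVec g)⟫_ℂ + ⟪expVec f, α (expVec g)⟫_ℂ := by
  linear_combination (hAk.matrix_eq f g - hA.two_mul_inner f g) / 2

theorem inner_creationExp_right (f g : Cplx 𝔥) :
    ⟪expVec f, A (creationExp (crePart k) g)⟫_ℂ =
      ⟪f, crePart k⟫_ℂ * ⟪expVec f, A (expVec g)⟫_ℂ + ⟪expVec f, α (expVec g)⟫_ℂ := by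
  linear_combination (-hAk.matrix_eq f g - hA.two_mul_inner f g) / 2

/-- `a(w') A Ω = (D_k A) Ω` if `A` commutes with `P(k₁) + Q(k₂) = a(w') + a⁺(w)`. -/
theorem annihilateQuant_apply_vacuum (t : Set.Ioo (0 : ℝ) 1) :
    annihilateQuant (annPart k) t (A vacuumVec) =
      ((t : ℝ) : ℂ) • secondQuant t (α vacuumVec) := by
  refine ext_inner_expVec fun f => ?_
  -- The vacuum enters here: `Ω = ℰ(0)` makes the scalar term `⟨w', 0⟩` vanish, leaving only the
  -- commutator.
  rw [← ContinuousLinearMap.adjoint_inner_left, adjoint_annihilateQuant_expVec, inner_smul_left,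
    Complex.conj_ofReal, vacuumVec, hA.inner_creationExp_left hAk, inner_zero_right, zero_mul,
    zero_add, inner_smul_right, ← inner_secondQuant_left, secondQuant_expVec]

/-- `a(w) A* Ω = (D_k A)* Ω` if `A` commutes with `P(k₁) + Q(k₂) = a(w') + a⁺(w)`. -/
theorem annihilateQuant_adjoint_apply_vacuum (t : Set.Ioo (0 : ℝ) 1) :
    annihilateQuant (crePart k) t (ContinuousLinearMap.adjoint A vacuumVec) =
      ((t : ℝ) : ℂ) • secondQuant t (ContinuousLinearMap.adjoint α vacuumVec) := by
  refine ext_inner_expVec fun f => ?_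
  have h : ⟪A (creationExp (crePart k) (((t : ℝ) : ℂ) • f)), expVec 0⟫_ℂ =
      ⟪α (expVec (((t : ℝ) : ℂ) • f)), expVec 0⟫_ℂ := by
    rw [← inner_conj_symm, hA.inner_creationExp_right hAk, inner_zero_left, zero_mul, zero_add,
      inner_conj_symm]
  rw [← ContinuousLinearMap.adjoint_inner_left, adjoint_annihilateQuant_expVec, inner_smul_left,
    Complex.conj_ofReal, vacuumVec, ContinuousLinearMap.adjoint_inner_right, h, inner_smul_right,
    ← inner_secondQuant_left, secondQuant_expVec, ContinuousLinearMap.adjoint_inner_right]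

end IsDirDeriv

/-- The relation `D_k B = ⟨k̄, DB⟩` passes from `𝒮` to the weak closure. -/
theorem IsGradient.isDirDeriv (hgen : ∀ (h : 𝔥 × 𝔥) (φ : ℝ × ℝ → ℂ), φ ∈ smoothSymbols h →
      ∀ k, IsDirDeriv k (opO h φ) (gradComp k
        (elemTensor (opO h (dx φ)) (Cplx.ofReal h.1, 0) +
          elemTensor (opO h (dy φ)) (0, Cplx.ofReal h.2))))
    {B : BFock 𝔥} {β : HModule 𝔥} (hB : IsGradient B β) (k : Cplx 𝔥 × Cplx 𝔥) :
    IsDirDeriv k B (gradComp k β) := by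
  have hgraph : ∀ (B : BFock 𝔥) (β : HModule 𝔥), DerivGraph B β → IsDirDeriv k B (gradComp k β) := by
    intro B β h
    induction h with
    | gen h φ hφ => exact hgen h φ hφ k
    | add _ _ hA hB => rw [gradComp_add]; exact hA.add hB
    | smul c _ hA => rw [gradComp_smul]; exact hA.smul c
    | mul _ _ hA hB => rw [gradComp_add, gradComp_leftAct, gradComp_comp]; exact hA.mul hB
  intro f g
  have hc1 : ∀ x y : Fock 𝔥, Continuous
      fun p : (Fock 𝔥 →WOT[ℂ] Fock 𝔥) × (Fock 𝔥 →WOT[ℂ] FockTensor 𝔥) => ⟪x, p.1 y⟫_ℂ := fun x y =>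
    (ContinuousLinearMapWOT.continuous_dual_apply y (innerSL ℂ x)).comp continuous_fst
  have hc2 : ∀ (x : FockTensor 𝔥) (y : Fock 𝔥), Continuous
      fun p : (Fock 𝔥 →WOT[ℂ] Fock 𝔥) × (Fock 𝔥 →WOT[ℂ] FockTensor 𝔥) => ⟪x, p.2 y⟫_ℂ := fun x y =>
    (ContinuousLinearMapWOT.continuous_dual_apply y (innerSL ℂ x)).comp continuous_snd
  -- For fixed `f`, `g` the unbounded operators act on exponential vectors only, so the condition
  -- compares finitely many matrix elements between fixed vectors and is weakly closed.
  have hclosed : IsClosed {p : (Fock 𝔥 →WOT[ℂ] Fock 𝔥) × (Fock 𝔥 →WOT[ℂ] FockTensor 𝔥) |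
      ⟪elemTensor 1 (bar₂ k) (expVec f), p.2 (expVec g)⟫_ℂ = dirDerivMatrix k p.1.toCLM f g} :=
    isClosed_eq (hc2 _ _) (continuous_const.mul ((hc1 _ _).sub (hc1 _ _)))
  have hmem := closure_minimal (s := {p | DerivGraph p.1.toCLM p.2.toCLM}) (fun p hp => by
    have := hgraph _ _ hp f g
    rwa [inner_gradComp] at this) hclosed hB
  rw [inner_gradComp]
  exact hmem

/-! ### Divergence and integration by parts in the vacuum state. -/

theorem divergence_hasMatrix {n : ℕ} {F : Fin n → BFock 𝔥} {h : Fin n → Cplx 𝔥 × Cplx 𝔥}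
    (hu : MemDivergenceDomain F h) : HasMatrix (divergence F h) (divergenceMatrix F h) := by
  rw [divergence, boundedOf, dif_pos hu.2]
  exact hu.2.choose_spec

/-- The normally ordered form of `δ(u)`, sandwiched between two copies of `S`, is an identity of
bounded operators. Agreement on exponential vectors therefore gives it for all `x`, `y`, in
particular for `A* Ω` and `B Ω`. -/
theorem secondQuant_divergence {n : ℕ} {F : Fin n → BFock 𝔥} {h : Fin n → Cplx 𝔥 × Cplx 𝔥}
    (hu : MemDivergenceDomain F h) (t : Set.Ioo (0 : ℝ) 1) (x y : Fock 𝔥) :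
    ⟪secondQuant t x, divergence F h (secondQuant t y)⟫_ℂ =
      ∑ j, (⟪annihilateQuant (crePart (h j)) t x, F j (secondQuant t y)⟫_ℂ +
        ⟪secondQuant t x, F j (annihilateQuant (annPart (h j)) t y)⟫_ℂ) := by
  have key : (secondQuant t).comp ((divergence F h).comp (secondQuant t)) =
      ∑ j, ((ContinuousLinearMap.adjoint (annihilateQuant (crePart (h j)) t)).comp
          ((F j).comp (secondQuant t)) +
        (secondQuant t).comp ((F j).comp (annihilateQuant (annPart (h j)) t))) := by
    refine ext_matrix fun f g => ?_
    simp only [sum_apply, _root_.add_apply, ContinuousLinearMap.comp_apply, inner_sum,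
      inner_add_right, ContinuousLinearMap.adjoint_inner_right, ← inner_secondQuant_left,
      secondQuant_expVec, annihilateQuant_expVec, divergence_hasMatrix hu _ _,
      divergenceMatrix_eq]
    refine Finset.sum_congr rfl fun j _ => ?_
    rw [map_smul, inner_smul_left (expVec _), inner_smul_right (expVec _), inner_conj_symm, add_mul]
  have h1 := congrArg (fun T : BFock 𝔥 => ⟪x, T y⟫_ℂ) key
  simpa only [sum_apply, _root_.add_apply, ContinuousLinearMap.comp_apply, inner_sum,
    inner_add_right, ContinuousLinearMap.adjoint_inner_right, ← inner_secondQuant_left] using h1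

/-- Commutation turns `a(w) S A* Ω` and `a(w') S B Ω` into `t S` applied to the directional
derivatives, so nothing blows up and the limit `t → 1` can be taken on both sides. -/
theorem vacuumState_mul_divergence_mul {n : ℕ} {F : Fin n → BFock 𝔥}
    {h : Fin n → Cplx 𝔥 × Cplx 𝔥} (hu : MemDivergenceDomain F h) {A B : BFock 𝔥}
    {α β : Fin n → BFock 𝔥} (hA : ∀ j, IsDirDeriv (h j) A (α j))
    (hB : ∀ j, IsDirDeriv (h j) B (β j)) (hAcomm : ∀ j, CommutesWithField A (h j))
    (hBcomm : ∀ j, CommutesWithField B (h j)) :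
    vacuumState (A * divergence F h * B) =
      vacuumState (A * (∑ j, F j * β j) + (∑ j, α j * F j) * B) := by
  set x : Fock 𝔥 := ContinuousLinearMap.adjoint A vacuumVec
  set y : Fock 𝔥 := B vacuumVec
  have hc : ∀ (C : BFock 𝔥) (u v : Fock 𝔥), Tendsto (fun t : Set.Ioo (0 : ℝ) 1 =>
      ⟪secondQuant t u, C (secondQuant t v)⟫_ℂ) toOne (𝓝 ⟪u, C v⟫_ℂ) := fun C u v =>
    (tendsto_secondQuant u).inner ((C.continuous.tendsto v).comp (tendsto_secondQuant v))
  have ht : Tendsto (fun t : Set.Ioo (0 : ℝ) 1 => ((t : ℝ) : ℂ)) toOne (𝓝 1) := by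
    simpa [Function.comp_def] using (Complex.continuous_ofReal.tendsto 1).comp tendsto_toOne
  have h1 := hc (divergence F h) x y
  have h2 : Tendsto (fun t : Set.Ioo (0 : ℝ) 1 => ⟪secondQuant t x,
      divergence F h (secondQuant t y)⟫_ℂ) toOne
      (𝓝 (∑ j, 1 * (⟪ContinuousLinearMap.adjoint (α j) vacuumVec, F j y⟫_ℂ +
        ⟪x, F j (β j vacuumVec)⟫_ℂ))) := by
    refine (tendsto_finsetSum _ fun j _ => ht.mul ((hc (F j)
      (ContinuousLinearMap.adjoint (α j) vacuumVec) y).add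
        (hc (F j) x (β j vacuumVec)))).congr fun t => ?_
    rw [secondQuant_divergence hu]
    refine Finset.sum_congr rfl fun j _ => ?_
    rw [(hA j).annihilateQuant_adjoint_apply_vacuum (hAcomm j),
      (hB j).annihilateQuant_apply_vacuum (hBcomm j), map_smul, inner_smul_left, inner_smul_right,
      Complex.conj_ofReal, mul_add]
  have key := tendsto_nhds_unique h1 h2
  simp only [vacuumState, mul_apply_eq_comp, _root_.add_apply, sum_apply,
    inner_add_right, map_sum, inner_sum]
  simp only [one_mul, Finset.sum_add_distrib, x, y, ContinuousLinearMap.adjoint_inner_left] at key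
  rw [key, add_comm]

/-! ### Gaussian integrals -/

section Gaussian

open ProbabilityTheory
open scoped NNReal

/-- The centred Gaussian measure on `ℝ²` with independent components of variances `v₁`, `v₂`. -/
def gaussianPlane (v₁ v₂ : ℝ≥0) : Measure (ℝ × ℝ) := (gaussianReal 0 v₁).prod (gaussianReal 0 v₂)

instance (v₁ v₂ : ℝ≥0) : IsProbabilityMeasure (gaussianPlane v₁ v₂) := by
  unfold gaussianPlane; infer_instance

/-- The exponential weight `exp (c x + d y)`. -/
def expWeight (c d : ℂ) (p : ℝ × ℝ) : ℂ := Complex.exp (c * p.1 + d * p.2)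

theorem continuous_expWeight (c d : ℂ) : Continuous (expWeight c d) := by
  unfold expWeight; fun_prop

theorem norm_expWeight_le (c d : ℂ) (p : ℝ × ℝ) :
    ‖expWeight c d p‖ ≤ Real.exp (‖c‖ * |p.1| + ‖d‖ * |p.2|) := by
  rw [expWeight, Complex.norm_exp]
  gcongr
  refine (Complex.re_le_norm _).trans ((norm_add_le _ _).trans (le_of_eq ?_))
  simp

theorem integrable_cexp_gaussianReal (v : ℝ≥0) (z : ℂ) :
    Integrable (fun x : ℝ => Complex.exp (z * x)) (gaussianReal 0 v) := by
  refine (integrable_exp_mul_gaussianReal (μ := 0) (v := v) z.re).mono'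
    (by fun_prop) (Eventually.of_forall fun x => ?_)
  rw [Complex.norm_exp]
  simp

theorem integral_cexp_gaussianReal (v : ℝ≥0) (z : ℂ) :
    ∫ x : ℝ, Complex.exp (z * x) ∂(gaussianReal 0 v) = Complex.exp (v * z ^ 2 / 2) := by
  have h := complexMGF_id_gaussianReal (μ := 0) (v := v) z
  simpa [complexMGF] using h

theorem expWeight_eq_mul (c d : ℂ) (p : ℝ × ℝ) :
    expWeight c d p = Complex.exp (c * p.1) * Complex.exp (d * p.2) := Complex.exp_add _ _

theorem integrable_expWeight (v₁ v₂ : ℝ≥0) (c d : ℂ) :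
    Integrable (expWeight c d) (gaussianPlane v₁ v₂) := by
  simp only [funext (expWeight_eq_mul c d)]
  exact (integrable_cexp_gaussianReal v₁ c).mul_prod (integrable_cexp_gaussianReal v₂ d)

theorem integral_expWeight (v₁ v₂ : ℝ≥0) (c d : ℂ) :
    ∫ p, expWeight c d p ∂(gaussianPlane v₁ v₂) =
      Complex.exp (v₁ * c ^ 2 / 2 + v₂ * d ^ 2 / 2) := by
  simp only [expWeight_eq_mul, gaussianPlane]
  rw [integral_prod_mul (fun x : ℝ => Complex.exp (c * x)) (fun y : ℝ => Complex.exp (d * y)),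
    integral_cexp_gaussianReal, integral_cexp_gaussianReal, Complex.exp_add]

/-- Stein's identity for a Gaussian measure with an exponential weight. -/
theorem integral_gaussianReal_stein {v : ℝ≥0} (hv : v ≠ 0) {ψ ψ' : ℝ → ℂ}
    (hψ : ∀ x, HasDerivAt ψ (ψ' x) x) (c w : ℂ)
    (h₀ : Integrable (fun x : ℝ => ψ x * Complex.exp (c * x + w)) (gaussianReal 0 v))
    (h₁ : Integrable (fun x : ℝ => (ψ' x - ψ x * (x / v - c)) * Complex.exp (c * x + w))
      (gaussianReal 0 v)) :
    ∫ x : ℝ, (ψ' x - ψ x * (x / v - c)) * Complex.exp (c * x + w) ∂(gaussianReal 0 v) = 0 := by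
  have hint : ∀ f : ℝ → ℂ, Integrable f (gaussianReal 0 v) →
      Integrable (fun x => gaussianPDFReal 0 v x • f x) := by
    intro f hf
    rw [gaussianReal_of_var_ne_zero _ hv, integrable_withDensity_iff_integrable_smul'
      (measurable_gaussianPDF 0 v) (ae_of_all _ fun _ => gaussianPDF_lt_top)] at hf
    simpa only [toReal_gaussianPDF] using hf
  rw [integral_gaussianReal_eq_integral_smul hv]
  -- The integrand, times the Gaussian density, is the derivative of density times `ψ` times the
  -- exponential.
  refine integral_eq_zero_of_hasDerivAt_of_integrable (fun x => ?_) (hint _ h₁) (hint _ h₀)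
  have hv' : (v : ℝ) ≠ 0 := by exact_mod_cast hv
  have e1 : HasDerivAt (gaussianPDFReal 0 v) (gaussianPDFReal 0 v x * (-(x / v))) x := by
    rw [gaussianPDFReal_def]
    have e2 : HasDerivAt (fun x : ℝ => -(x - 0) ^ 2 / (2 * (v : ℝ))) (-(x / v)) x := by
      refine ((((hasDerivAt_id x).sub_const 0).pow 2).neg.div_const (2 * (v : ℝ))).congr_deriv ?_
      simp only [id]
      field_simp
      norm_num [mul_comm]
    refine (e2.exp.const_mul _).congr_deriv ?_
    ring
  have e3 : HasDerivAt (fun x : ℝ => Complex.exp (c * x + w)) (Complex.exp (c * x + w) * c) x := by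
    have e4 : HasDerivAt (fun x : ℝ => c * (x : ℂ) + w) c x := by
      simpa using ((Complex.ofRealCLM.hasDerivAt (x := x)).const_mul c).add_const w
    exact e4.cexp
  refine (e1.smul ((hψ x).mul e3)).congr_deriv ?_
  simp only [Complex.real_smul, Pi.mul_apply]
  push_cast
  ring

/-- `φ` has all exponential moments with respect to `gaussianPlane v₁ v₂`. -/
def HasExpMoments (v₁ v₂ : ℝ≥0) (φ : ℝ × ℝ → ℂ) : Prop :=
  ∀ A B : ℝ, (v₁ = 0 → A = 0) → (v₂ = 0 → B = 0) →
    Integrable (fun p => ‖φ p‖ * Real.exp (A * |p.1| + B * |p.2|)) (gaussianPlane v₁ v₂)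

variable {v₁ v₂ : ℝ≥0} {φ : ℝ × ℝ → ℂ}

theorem HasExpMoments.integrable_mul (hφ : HasExpMoments v₁ v₂ φ) (hc : Continuous φ)
    {w : ℝ × ℝ → ℂ} (hw : Continuous w) {A B : ℝ} (hA : v₁ = 0 → A = 0) (hB : v₂ = 0 → B = 0)
    (hle : ∀ p, ‖w p‖ ≤ Real.exp (A * |p.1| + B * |p.2|)) :
    Integrable (fun p => φ p * w p) (gaussianPlane v₁ v₂) := by
  refine (hφ A B hA hB).mono' (hc.mul hw).aestronglyMeasurable (Eventually.of_forall fun p => ?_)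
  rw [norm_mul]
  gcongr
  exact hle p

theorem HasExpMoments.integrable_mul_expWeight (hφ : HasExpMoments v₁ v₂ φ) (hc : Continuous φ)
    {c d : ℂ} (h₁ : v₁ = 0 → c = 0) (h₂ : v₂ = 0 → d = 0) :
    Integrable (fun p => φ p * expWeight c d p) (gaussianPlane v₁ v₂) :=
  hφ.integrable_mul hc (continuous_expWeight c d) (fun h => by rw [h₁ h, norm_zero])
    (fun h => by rw [h₂ h, norm_zero]) (norm_expWeight_le c d)

/-- The linear factor is absorbed into the exponential by `r ≤ exp r`. The bound is uniform for `c`,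
`d` in bounded sets, as needed for differentiation under the integral. -/
theorem norm_linear_mul_expWeight_le {C D : ℝ} (c' d' : ℂ) {c d : ℂ} (hc : ‖c‖ ≤ C) (hd : ‖d‖ ≤ D)
    (p : ℝ × ℝ) : ‖(c' * p.1 + d' * p.2) * expWeight c d p‖ ≤
      Real.exp ((C + ‖c'‖) * |p.1| + (D + ‖d'‖) * |p.2|) := by
  have h1 : ‖c' * (p.1 : ℂ) + d' * p.2‖ ≤ ‖c'‖ * |p.1| + ‖d'‖ * |p.2| :=
    (norm_add_le _ _).trans (le_of_eq (by simp))
  have h2 := norm_expWeight_le c d p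
  have h3 : ‖c'‖ * |p.1| + ‖d'‖ * |p.2| ≤ Real.exp (‖c'‖ * |p.1| + ‖d'‖ * |p.2|) :=
    (le_add_of_nonneg_right zero_le_one).trans (Real.add_one_le_exp _)
  rw [norm_mul]
  refine (mul_le_mul (h1.trans h3) h2 (norm_nonneg _) (Real.exp_nonneg _)).trans ?_
  rw [← Real.exp_add]
  refine Real.exp_le_exp.2 ?_
  have := mul_le_mul_of_nonneg_right hc (abs_nonneg p.1)
  have := mul_le_mul_of_nonneg_right hd (abs_nonneg p.2)
  linarith

theorem HasExpMoments.integrable_linear_mul (hφ : HasExpMoments v₁ v₂ φ) (hc : Continuous φ)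
    {c d c' d' : ℂ} (h₁ : v₁ = 0 → c = 0) (h₂ : v₂ = 0 → d = 0) (h₁' : v₁ = 0 → c' = 0)
    (h₂' : v₂ = 0 → d' = 0) :
    Integrable (fun p => φ p * ((c' * p.1 + d' * p.2) * expWeight c d p)) (gaussianPlane v₁ v₂) :=
  hφ.integrable_mul hc
    (Continuous.mul (by fun_prop) (continuous_expWeight c d))
    (fun h => by rw [h₁ h, h₁' h, norm_zero, add_zero])
    (fun h => by rw [h₂ h, h₂' h, norm_zero, add_zero])
    (norm_linear_mul_expWeight_le c' d' le_rfl le_rfl)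

theorem HasExpMoments.hasDerivAt_integral (hφ : HasExpMoments v₁ v₂ φ) (hc : Continuous φ)
    {c d c' d' : ℂ} (h₁ : v₁ = 0 → c = 0) (h₂ : v₂ = 0 → d = 0) (h₁' : v₁ = 0 → c' = 0)
    (h₂' : v₂ = 0 → d' = 0) :
    HasDerivAt (fun s : ℝ => ∫ p, φ p * expWeight (c + s * c') (d + s * d') p ∂(gaussianPlane v₁ v₂))
      (∫ p, φ p * ((c' * p.1 + d' * p.2) * expWeight c d p) ∂(gaussianPlane v₁ v₂)) 0 := by
  have h := hasDerivAt_integral_of_dominated_loc_of_deriv_le (μ := gaussianPlane v₁ v₂) (𝕜 := ℝ)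
    (F := fun s p => φ p * expWeight (c + (s : ℂ) * c') (d + (s : ℂ) * d') p)
    (F' := fun s p => φ p * ((c' * p.1 + d' * p.2) * expWeight (c + (s : ℂ) * c') (d + (s : ℂ) * d') p))
    (x₀ := 0) (s := Metric.ball 0 1)
    (bound := fun p => ‖φ p‖ * Real.exp ((‖c‖ + ‖c'‖ + ‖c'‖) * |p.1| + (‖d‖ + ‖d'‖ + ‖d'‖) * |p.2|))
    (Metric.ball_mem_nhds 0 one_pos)
    (Eventually.of_forall fun s => (hc.mul (continuous_expWeight _ _)).aestronglyMeasurable)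
    (hφ.integrable_mul_expWeight hc (fun h => by simp [h₁ h, h₁' h])
      (fun h => by simp [h₂ h, h₂' h]))
    (hc.mul (Continuous.mul (by fun_prop) (continuous_expWeight _ _))).aestronglyMeasurable
    (Eventually.of_forall fun p s hs => ?_)
    (hφ _ _ (fun h => by simp [h₁ h, h₁' h]) (fun h => by simp [h₂ h, h₂' h]))
    (Eventually.of_forall fun p s _ => ?_)
  · simpa using h.2
  · have hs' : |s| ≤ 1 := by
      have := mem_ball_zero_iff.1 hs
      rw [Real.norm_eq_abs] at this
      exact this.le
    have hle : ∀ a a' : ℂ, ‖a + (s : ℂ) * a'‖ ≤ ‖a‖ + ‖a'‖ := fun a a' => by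
      refine (norm_add_le _ _).trans ?_
      gcongr
      rw [norm_mul, Complex.norm_real, Real.norm_eq_abs]
      exact mul_le_of_le_one_left (norm_nonneg _) hs'
    rw [norm_mul]
    gcongr
    exact norm_linear_mul_expWeight_le c' d' (hle c c') (hle d d') p
  · have h1 : HasDerivAt (fun s : ℝ => (c + (s : ℂ) * c') * p.1 + (d + (s : ℂ) * d') * p.2)
        (c' * p.1 + d' * p.2) s := by
      have hid := Complex.ofRealCLM.hasDerivAt (x := s)
      simpa using (((hid.mul_const c').const_add c).mul_const (p.1 : ℂ)).fun_add
        (((hid.mul_const d').const_add d).mul_const (p.2 : ℂ))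
    refine (h1.cexp.const_mul (φ p)).congr_deriv ?_
    rw [expWeight]
    ring

/-- By Fubini this is the one-dimensional identity in `x` for almost every `y`, the factor `exp (d
y)` being a constant there. -/
theorem HasExpMoments.stein_fst (hv : v₁ ≠ 0) {φ' : ℝ × ℝ → ℂ} (hφ : HasExpMoments v₁ v₂ φ)
    (hc : Continuous φ) (hφ' : HasExpMoments v₁ v₂ φ') (hc' : Continuous φ')
    (hd : ∀ x y, HasDerivAt (fun x => φ (x, y)) (φ' (x, y)) x) {c d : ℂ} (h₂ : v₂ = 0 → d = 0) :
    ∫ p, φ' p * expWeight c d p ∂(gaussianPlane v₁ v₂) =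
      ∫ p, φ p * (((v₁ : ℂ)⁻¹ * p.1 + 0 * p.2) * expWeight c d p) ∂(gaussianPlane v₁ v₂) -
      c * ∫ p, φ p * expWeight c d p ∂(gaussianPlane v₁ v₂) := by
  have i0 := hφ.integrable_mul_expWeight hc (c := c) (fun h => absurd h hv) h₂
  have i1 := hφ'.integrable_mul_expWeight hc' (c := c) (fun h => absurd h hv) h₂
  have i2 := hφ.integrable_linear_mul hc (c := c) (c' := (v₁ : ℂ)⁻¹) (d' := 0)
    (fun h => absurd h hv) h₂ (fun h => absurd h hv) (fun _ => rfl)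
  have i4 : Integrable (fun p => φ p * (((v₁ : ℂ)⁻¹ * p.1 + 0 * p.2) * expWeight c d p) -
      c * (φ p * expWeight c d p)) (gaussianPlane v₁ v₂) := i2.sub (i0.const_mul c)
  have i3 : Integrable (fun p => φ' p * expWeight c d p -
      (φ p * (((v₁ : ℂ)⁻¹ * p.1 + 0 * p.2) * expWeight c d p) - c * (φ p * expWeight c d p)))
      (gaussianPlane v₁ v₂) := i1.sub i4
  have hzero : ∫ p, (φ' p * expWeight c d p -
      (φ p * (((v₁ : ℂ)⁻¹ * p.1 + 0 * p.2) * expWeight c d p) - c * (φ p * expWeight c d p)))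
        ∂(gaussianPlane v₁ v₂) = 0 := by
    rw [gaussianPlane] at i0 i3 ⊢
    rw [integral_prod_symm _ i3]
    refine integral_eq_zero_of_ae ?_
    filter_upwards [i3.prod_left_ae, i0.prod_left_ae] with y h3 h0
    have e := integral_gaussianReal_stein hv (fun x => hd x y) c (d * y) h0
    have e' : ∀ x : ℝ, (φ' (x, y) - φ (x, y) * (x / v₁ - c)) * Complex.exp (c * x + d * y) =
        φ' (x, y) * expWeight c d (x, y) - (φ (x, y) * (((v₁ : ℂ)⁻¹ * x + 0 * y) *
          expWeight c d (x, y)) - c * (φ (x, y) * expWeight c d (x, y))) := fun x => by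
      rw [expWeight]; ring
    simp only [e'] at e
    exact e h3
  rw [integral_sub i1 i4, integral_sub i2 (i0.const_mul c),
    integral_const_mul] at hzero
  exact sub_eq_zero.1 hzero

theorem HasExpMoments.stein_snd (hv : v₂ ≠ 0) {φ' : ℝ × ℝ → ℂ} (hφ : HasExpMoments v₁ v₂ φ)
    (hc : Continuous φ) (hφ' : HasExpMoments v₁ v₂ φ') (hc' : Continuous φ')
    (hd : ∀ x y, HasDerivAt (fun y => φ (x, y)) (φ' (x, y)) y) {c d : ℂ} (h₁ : v₁ = 0 → c = 0) :
    ∫ p, φ' p * expWeight c d p ∂(gaussianPlane v₁ v₂) =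
      ∫ p, φ p * ((0 * p.1 + (v₂ : ℂ)⁻¹ * p.2) * expWeight c d p) ∂(gaussianPlane v₁ v₂) -
      d * ∫ p, φ p * expWeight c d p ∂(gaussianPlane v₁ v₂) := by
  have i0 := hφ.integrable_mul_expWeight hc (d := d) h₁ (fun h => absurd h hv)
  have i1 := hφ'.integrable_mul_expWeight hc' (d := d) h₁ (fun h => absurd h hv)
  have i2 := hφ.integrable_linear_mul hc (d := d) (c' := 0) (d' := (v₂ : ℂ)⁻¹)
    h₁ (fun h => absurd h hv) (fun _ => rfl) (fun h => absurd h hv)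
  have i4 : Integrable (fun p => φ p * ((0 * p.1 + (v₂ : ℂ)⁻¹ * p.2) * expWeight c d p) -
      d * (φ p * expWeight c d p)) (gaussianPlane v₁ v₂) := i2.sub (i0.const_mul d)
  have i3 : Integrable (fun p => φ' p * expWeight c d p -
      (φ p * ((0 * p.1 + (v₂ : ℂ)⁻¹ * p.2) * expWeight c d p) - d * (φ p * expWeight c d p)))
      (gaussianPlane v₁ v₂) := i1.sub i4
  have hzero : ∫ p, (φ' p * expWeight c d p -
      (φ p * ((0 * p.1 + (v₂ : ℂ)⁻¹ * p.2) * expWeight c d p) - d * (φ p * expWeight c d p)))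
        ∂(gaussianPlane v₁ v₂) = 0 := by
    have e' : ∀ x y : ℝ, (φ' (x, y) - φ (x, y) * (y / v₂ - d)) * Complex.exp (d * y + c * x) =
        φ' (x, y) * expWeight c d (x, y) - (φ (x, y) * ((0 * x + (v₂ : ℂ)⁻¹ * y) *
          expWeight c d (x, y)) - d * (φ (x, y) * expWeight c d (x, y))) := fun x y => by
      rw [expWeight, add_comm (d * _)]; ring
    rw [gaussianPlane] at i0 i3 ⊢
    rw [integral_prod _ i3]
    refine integral_eq_zero_of_ae ?_
    filter_upwards [i3.prod_right_ae, i0.prod_right_ae] with x h3 h0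
    have e := integral_gaussianReal_stein hv (fun y => hd x y) d (c * x)
      (by simpa only [expWeight, add_comm] using h0)
    simp only [e'] at e
    exact e h3
  rw [integral_sub i1 i4, integral_sub i2 (i0.const_mul d),
    integral_const_mul] at hzero
  exact sub_eq_zero.1 hzero

end Gaussian

/-! ### Stein's identity on the plane, and regularity of the symbols. -/

section Stein

open scoped NNReal

variable {v₁ v₂ : ℝ≥0} {φ : ℝ × ℝ → ℂ}

/-- A coordinate of variance zero admits no integration by parts, but its coefficient then vanishes
and, division by zero being zero, so does its term on the right. -/
theorem HasExpMoments.stein {φx φy : ℝ × ℝ → ℂ} (hφ : HasExpMoments v₁ v₂ φ) (hc : Continuous φ)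
    (hφx : HasExpMoments v₁ v₂ φx) (hcx : Continuous φx) (hφy : HasExpMoments v₁ v₂ φy)
    (hcy : Continuous φy) (hdx : ∀ x y, HasDerivAt (fun x => φ (x, y)) (φx (x, y)) x)
    (hdy : ∀ x y, HasDerivAt (fun y => φ (x, y)) (φy (x, y)) y) {c d l₁ l₂ : ℂ}
    (h₁ : v₁ = 0 → c = 0) (h₂ : v₂ = 0 → d = 0) (h₁' : v₁ = 0 → l₁ = 0) (h₂' : v₂ = 0 → l₂ = 0) :
    l₁ * ∫ p, φx p * expWeight c d p ∂(gaussianPlane v₁ v₂) +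
        l₂ * ∫ p, φy p * expWeight c d p ∂(gaussianPlane v₁ v₂) =
      ∫ p, φ p * ((l₁ / v₁ * p.1 + l₂ / v₂ * p.2) * expWeight c d p) ∂(gaussianPlane v₁ v₂) -
        (l₁ * c + l₂ * d) * ∫ p, φ p * expWeight c d p ∂(gaussianPlane v₁ v₂) := by
  have e₁ : l₁ * ∫ p, φx p * expWeight c d p ∂(gaussianPlane v₁ v₂) =
      ∫ p, φ p * ((l₁ / v₁ * p.1 + 0 * p.2) * expWeight c d p) ∂(gaussianPlane v₁ v₂) -
        l₁ * c * ∫ p, φ p * expWeight c d p ∂(gaussianPlane v₁ v₂) := by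
    by_cases hv : v₁ = 0
    · simp [h₁' hv]
    · rw [hφ.stein_fst hv hc hφx hcx hdx h₂, mul_sub, ← integral_const_mul, mul_assoc]
      congr 2
      funext p
      ring
  have e₂ : l₂ * ∫ p, φy p * expWeight c d p ∂(gaussianPlane v₁ v₂) =
      ∫ p, φ p * ((0 * p.1 + l₂ / v₂ * p.2) * expWeight c d p) ∂(gaussianPlane v₁ v₂) -
        l₂ * d * ∫ p, φ p * expWeight c d p ∂(gaussianPlane v₁ v₂) := by
    by_cases hv : v₂ = 0
    · simp [h₂' hv]
    · rw [hφ.stein_snd hv hc hφy hcy hdy h₁, mul_sub, ← integral_const_mul, mul_assoc]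
      congr 2
      funext p
      ring
  have e₃ : ∫ p, φ p * ((l₁ / v₁ * p.1 + l₂ / v₂ * p.2) * expWeight c d p) ∂(gaussianPlane v₁ v₂) =
      ∫ p, φ p * ((l₁ / v₁ * p.1 + 0 * p.2) * expWeight c d p) ∂(gaussianPlane v₁ v₂) +
      ∫ p, φ p * ((0 * p.1 + l₂ / v₂ * p.2) * expWeight c d p) ∂(gaussianPlane v₁ v₂) := by
    rw [← integral_add
      (hφ.integrable_linear_mul hc h₁ h₂ (fun h => by simp [h]) (fun _ => rfl))
      (hφ.integrable_linear_mul hc h₁ h₂ (fun _ => rfl) (fun h => by simp [h]))]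
    congr 1
    funext p
    ring
  rw [e₁, e₂, e₃]
  ring

/-- Exponential moments follow from integrability against real exponential weights. -/
theorem HasExpMoments.of_integrable (hc : Continuous φ)
    (h : ∀ a b : ℝ, (v₁ = 0 → a = 0) → (v₂ = 0 → b = 0) →
      Integrable (fun p => φ p * expWeight a b p) (gaussianPlane v₁ v₂)) :
    HasExpMoments v₁ v₂ φ := by
  intro A B hA hB
  have hn : ∀ a b : ℝ, (v₁ = 0 → a = 0) → (v₂ = 0 → b = 0) →
      Integrable (fun p => ‖φ p‖ * Real.exp (a * p.1 + b * p.2)) (gaussianPlane v₁ v₂) := by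
    intro a b ha hb
    refine (h a b ha hb).norm.congr (Eventually.of_forall fun p => ?_)
    simp [expWeight, Complex.norm_exp]
  have hA' : v₁ = 0 → -A = 0 := fun h => by rw [hA h, neg_zero]
  have hB' : v₂ = 0 → -B = 0 := fun h => by rw [hB h, neg_zero]
  -- `exp (A |x| + B |y|)` is one of the four exponentials `exp (± A x ± B y)`, hence at most their
  -- sum.
  refine (((hn A B hA hB).add (hn A (-B) hA hB')).add
    ((hn (-A) B hA' hB).add (hn (-A) (-B) hA' hB'))).mono'
    (hc.norm.mul (by fun_prop)).aestronglyMeasurable (Eventually.of_forall fun p => ?_)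
  rw [Real.norm_of_nonneg (by positivity)]
  simp only [Pi.add_apply, ← mul_add]
  gcongr
  have e1 := Real.exp_pos (A * p.1 + B * p.2)
  have e2 := Real.exp_pos (A * p.1 + -B * p.2)
  have e3 := Real.exp_pos (-A * p.1 + B * p.2)
  have e4 := Real.exp_pos (-A * p.1 + -B * p.2)
  rcases abs_choice p.1 with h1 | h1 <;> rcases abs_choice p.2 with h2 | h2 <;>
    rw [h1, h2] <;> (try simp only [mul_neg, ← neg_mul]) <;> linarith

theorem hasDerivAt_dx (hφ : ContDiff ℝ (⊤ : ℕ∞) φ) (x y : ℝ) :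
    HasDerivAt (fun x => φ (x, y)) (dx φ (x, y)) x := by
  have h : DifferentiableAt ℝ (fun x => φ (x, y)) x :=
    (hφ.differentiable (by simp) (x, y)).comp x (by fun_prop)
  exact h.hasDerivAt

theorem hasDerivAt_dy (hφ : ContDiff ℝ (⊤ : ℕ∞) φ) (x y : ℝ) :
    HasDerivAt (fun y => φ (x, y)) (dy φ (x, y)) y := by
  have h : DifferentiableAt ℝ (fun y => φ (x, y)) y :=
    (hφ.differentiable (by simp) (x, y)).comp y (by fun_prop)
  exact h.hasDerivAt

theorem continuous_dx (hφ : ContDiff ℝ (⊤ : ℕ∞) φ) : Continuous (dx φ) := by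
  have h : dx φ = fun p => fderiv ℝ φ p (1, 0) := by
    funext p
    exact (hasDerivAt_dx hφ p.1 p.2).unique
      ((hφ.differentiable (by simp) p).hasFDerivAt.comp_hasDerivAt p.1
        ((hasDerivAt_id p.1).prodMk (hasDerivAt_const p.1 p.2)))
  rw [h]
  exact (hφ.continuous_fderiv (by simp)).clm_apply continuous_const

theorem continuous_dy (hφ : ContDiff ℝ (⊤ : ℕ∞) φ) : Continuous (dy φ) := by
  have h : dy φ = fun p => fderiv ℝ φ p (0, 1) := by
    funext p
    exact (hasDerivAt_dy hφ p.1 p.2).unique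
      ((hφ.differentiable (by simp) p).hasFDerivAt.comp_hasDerivAt p.2
        ((hasDerivAt_const p.2 p.1).prodMk (hasDerivAt_id p.2)))
  rw [h]
  exact (hφ.continuous_fderiv (by simp)).clm_apply continuous_const

end Stein

/-! ### The Wigner density of a pair of exponential vectors -/

section Wigner

variable (h : 𝔥 × 𝔥) (f g : Cplx 𝔥)

/-- The first component of the complex mean of the Wigner density. -/
def wignerMean₁ : ℂ := -Complex.I * (⟪f, Cplx.ofReal h.1⟫_ℂ - ⟪Cplx.ofReal h.1, g⟫_ℂ)

/-- The second component of the complex mean of the Wigner density. -/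
def wignerMean₂ : ℂ := ⟪f, Cplx.ofReal h.2⟫_ℂ + ⟪Cplx.ofReal h.2, g⟫_ℂ

/-- The measure of reference for the Wigner densities. -/
def wignerMeasure : Measure (ℝ × ℝ) := gaussianPlane (‖h.1‖₊ ^ 2) (‖h.2‖₊ ^ 2)

instance : IsProbabilityMeasure (wignerMeasure h) := by
  unfold wignerMeasure; infer_instance

/-- The normalization constant of the Wigner density. -/
def wignerConst : ℂ :=
  Complex.exp (⟪f, g⟫_ℂ - ‖h.1‖ ^ 2 * (wignerMean₁ h f g / ‖h.1‖ ^ 2) ^ 2 / 2 -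
    ‖h.2‖ ^ 2 * (wignerMean₂ h f g / ‖h.2‖ ^ 2) ^ 2 / 2)

/-- The tilt of the Wigner density. -/
def wignerWeight : ℝ × ℝ → ℂ :=
  expWeight (wignerMean₁ h f g / ‖h.1‖ ^ 2) (wignerMean₂ h f g / ‖h.2‖ ^ 2)

theorem inner_bar_ofReal (k : Cplx 𝔥) (x : 𝔥) :
    ⟪k.bar, Cplx.ofReal x⟫_ℂ = ⟪Cplx.ofReal x, k⟫_ℂ := by
  rw [Cplx.inner_def, Cplx.inner_def]
  simp [Cplx.bar, Cplx.ofReal, real_inner_comm]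

theorem ofReal_eq_zero_of_norm_eq_zero {x : 𝔥} (hx : ‖x‖ = 0) : Cplx.ofReal x = 0 := by
  rw [norm_eq_zero.1 hx]; rfl

/-- The cancellation survives at `h.1 = 0`, since the mean vanishes there as well. -/
theorem mul_wignerMean₁_div :
    (‖h.1‖ ^ 2 : ℂ) * (wignerMean₁ h f g / ‖h.1‖ ^ 2) = wignerMean₁ h f g := by
  by_cases h0 : ‖h.1‖ = 0
  · simp [wignerMean₁, ofReal_eq_zero_of_norm_eq_zero h0]
  · exact mul_div_cancel₀ _ (by exact_mod_cast pow_ne_zero 2 h0)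

theorem mul_wignerMean₂_div :
    (‖h.2‖ ^ 2 : ℂ) * (wignerMean₂ h f g / ‖h.2‖ ^ 2) = wignerMean₂ h f g := by
  by_cases h0 : ‖h.2‖ = 0
  · simp [wignerMean₂, ofReal_eq_zero_of_norm_eq_zero h0]
  · exact mul_div_cancel₀ _ (by exact_mod_cast pow_ne_zero 2 h0)

theorem inner_weylExp (u v : ℝ) :
    ⟪expVec f, weylExp (u • h.1) (v • h.2) g⟫_ℂ =
      Complex.exp (⟪f, g⟫_ℂ + Complex.I * u * wignerMean₁ h f g + Complex.I * v * wignerMean₂ h f g -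
        ‖h.1‖ ^ 2 * u ^ 2 / 2 - ‖h.2‖ ^ 2 * v ^ 2 / 2) := by
  have hz : (⟨u • h.1, v • h.2⟩ : Cplx 𝔥) =
      (u : ℂ) • Cplx.ofReal h.1 + (Complex.I * v) • Cplx.ofReal h.2 := by
    ext <;> simp [Cplx.ofReal, -Complex.coe_smul]
  have hn : ‖(⟨u • h.1, v • h.2⟩ : Cplx 𝔥)‖ ^ 2 = u ^ 2 * ‖h.1‖ ^ 2 + v ^ 2 * ‖h.2‖ ^ 2 := by
    rw [← inner_self_eq_norm_sq (𝕜 := ℂ), Cplx.inner_def]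
    simp [norm_smul, mul_pow]
  rw [weylExp]
  rw [inner_smul_right, inner_expVec, hn, hz, ← Complex.exp_add]
  congr 1
  simp only [wignerMean₁, wignerMean₂, inner_add_left, inner_add_right, inner_smul_left,
    inner_smul_right, map_mul, Complex.conj_I, Complex.conj_ofReal]
  push_cast
  linear_combination (u * (⟪f, Cplx.ofReal h.1⟫_ℂ - ⟪Cplx.ofReal h.1, g⟫_ℂ)) * Complex.I_mul_I

/-- A Gaussian of variance `v` and mean `m` has density proportional to `exp (m x / v)` relative to
the centred one; this persists for complex `m`. The constant makes the total mass `exp ⟨f, g⟩`. -/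
theorem hasFourierTransform_wigner :
    HasFourierTransform (wignerMeasure h) (fun p => wignerConst h f g * wignerWeight h f g p)
      (fun u v => ⟪expVec f, weylExp (u • h.1) (v • h.2) g⟫_ℂ) := by
  refine ⟨(integrable_expWeight _ _ _ _).const_mul _, fun u v => ?_⟩
  have e : ∀ p : ℝ × ℝ, Complex.exp (Complex.I * (u * p.1 + v * p.2)) *
      (wignerConst h f g * wignerWeight h f g p) = wignerConst h f g *
      expWeight (wignerMean₁ h f g / ‖h.1‖ ^ 2 + Complex.I * u)
        (wignerMean₂ h f g / ‖h.2‖ ^ 2 + Complex.I * v) p := fun p => by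
    rw [mul_left_comm, wignerWeight, expWeight, expWeight, ← Complex.exp_add]
    congr 2
    ring
  simp only [e]
  rw [integral_const_mul, wignerMeasure, integral_expWeight, inner_weylExp, wignerConst,
    ← Complex.exp_add]
  congr 1
  push_cast [coe_nnnorm]
  linear_combination (-Complex.I * u) * mul_wignerMean₁_div h f g -
    (Complex.I * v) * mul_wignerMean₂_div h f g -
    (‖h.1‖ ^ 2 * u ^ 2 / 2 + ‖h.2‖ ^ 2 * v ^ 2 / 2 : ℂ) * Complex.I_mul_I

variable {h}

theorem IsWeylQuantization.integrable {φ : ℝ × ℝ → ℂ} {M : BFock 𝔥}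
    (hM : IsWeylQuantization h φ M) :
    Integrable (fun p => φ p * wignerWeight h f g p) (wignerMeasure h) := by
  have h1 := ((hM f g).2 (wignerMeasure h) _ inferInstance (hasFourierTransform_wigner h f g)).1
  refine (h1.const_mul (wignerConst h f g)⁻¹).congr (Eventually.of_forall fun p => ?_)
  have h2 : wignerConst h f g ≠ 0 := Complex.exp_ne_zero _
  field_simp

theorem IsWeylQuantization.inner_eq {φ : ℝ × ℝ → ℂ} {M : BFock 𝔥}
    (hM : IsWeylQuantization h φ M) :
    ⟪expVec f, M (expVec g)⟫_ℂ =
      wignerConst h f g * ∫ p, φ p * wignerWeight h f g p ∂(wignerMeasure h) := by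
  rw [← ((hM f g).2 (wignerMeasure h) _ inferInstance (hasFourierTransform_wigner h f g)).2,
    ← integral_const_mul]
  congr 1
  funext p
  ring

/-- Membership in the domain of `O_h` demands integrability against the Wigner measures of all pairs
of exponential vectors, and these realize every real exponential tilt in the nondegenerate
directions. -/
theorem IsWeylQuantization.hasExpMoments {φ : ℝ × ℝ → ℂ} {M : BFock 𝔥}
    (hM : IsWeylQuantization h φ M) (hc : Continuous φ) :
    HasExpMoments (‖h.1‖₊ ^ 2) (‖h.2‖₊ ^ 2) φ := by
  refine HasExpMoments.of_integrable hc fun a b ha hb => ?_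
  -- For `f = x + i y` the diagonal pair `(f, f)` has mean `(-2⟨y, h₁⟩, 2⟨x, h₂⟩)`; this choice
  -- makes it `(a ‖h₁‖², b ‖h₂‖²)`, so the tilt is `(a, b)`.
  let f : Cplx 𝔥 := ⟨(b / 2) • h.2, (-(a / 2)) • h.1⟩
  have h1 : wignerMean₁ h f f = ‖h.1‖ ^ 2 * a := by
    rw [wignerMean₁, Cplx.inner_def, Cplx.inner_def]
    apply Complex.ext <;>
      simp [f, Cplx.ofReal, inner_smul_left, inner_smul_right, real_inner_comm, ← Complex.ofReal_pow]
    ring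
  have h2 : wignerMean₂ h f f = ‖h.2‖ ^ 2 * b := by
    rw [wignerMean₂, Cplx.inner_def, Cplx.inner_def]
    apply Complex.ext <;>
      simp [f, Cplx.ofReal, inner_smul_left, inner_smul_right, real_inner_comm, ← Complex.ofReal_pow]
    ring
  have h3 : wignerMean₁ h f f / ‖h.1‖ ^ 2 = a := by
    by_cases h0 : ‖h.1‖ = 0
    · rw [ha (by simpa using h0)]; simp [h0]
    · rw [h1, mul_div_cancel_left₀ _ (by exact_mod_cast pow_ne_zero 2 h0)]
  have h4 : wignerMean₂ h f f / ‖h.2‖ ^ 2 = b := by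
    by_cases h0 : ‖h.2‖ = 0
    · rw [hb (by simpa using h0)]; simp [h0]
    · rw [h2, mul_div_cancel_left₀ _ (by exact_mod_cast pow_ne_zero 2 h0)]
  have h5 := hM.integrable f f
  rwa [wignerWeight, h3, h4] at h5

end Wigner

/-! ### Directional derivatives of Weyl quantizations. -/

theorem opO_spec {h : 𝔥 × 𝔥} {φ : ℝ × ℝ → ℂ} (hφ : φ ∈ domO h) :
    IsWeylQuantization h φ (opO h φ) := by
  rw [opO, dif_pos hφ]; exact hφ.choose_spec

theorem creationExp_smul (c : ℂ) (d f : Cplx 𝔥) :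
    creationExp (c • d) f = c • creationExp d f := by
  refine ext_inner_expVec fun g => ?_
  rw [inner_expVec_creationExp, inner_smul_right, inner_smul_right, inner_expVec_creationExp,
    mul_assoc]

/-- The directional derivative of `O_h(φ)`. -/
theorem isDirDeriv_opO (h : 𝔥 × 𝔥) (φ : ℝ × ℝ → ℂ) (hφ : φ ∈ smoothSymbols h)
    (k : Cplx 𝔥 × Cplx 𝔥) :
    IsDirDeriv k (opO h φ) (gradComp k
      (elemTensor (opO h (dx φ)) (Cplx.ofReal h.1, 0) +
        elemTensor (opO h (dy φ)) (0, Cplx.ofReal h.2))) := by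
  obtain ⟨hs, hdom⟩ := hφ
  have h0 := opO_spec (hdom 0 0)
  have hx := opO_spec (hdom 1 0)
  have hy := opO_spec (hdom 0 1)
  simp only [Function.iterate_zero, Function.iterate_one, id] at h0 hx hy
  intro f g
  set w' := annPart k with hw'
  set w := crePart k with hw
  set l₁ : ℂ := ⟪k.1.bar, Cplx.ofReal h.1⟫_ℂ
  set l₂ : ℂ := ⟪k.2.bar, Cplx.ofReal h.2⟫_ℂ
  set c : ℂ := wignerMean₁ h f g / ‖h.1‖ ^ 2
  set d : ℂ := wignerMean₂ h f g / ‖h.2‖ ^ 2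
  have hv₁ : ‖h.1‖₊ ^ 2 = 0 → ‖h.1‖ = 0 := fun e => by simpa using e
  have hv₂ : ‖h.2‖₊ ^ 2 = 0 → ‖h.2‖ = 0 := fun e => by simpa using e
  have zc : ‖h.1‖₊ ^ 2 = 0 → c = 0 := fun e => by simp [c, hv₁ e]
  have zd : ‖h.2‖₊ ^ 2 = 0 → d = 0 := fun e => by simp [d, hv₂ e]
  have zl₁ : ‖h.1‖₊ ^ 2 = 0 → l₁ = 0 := fun e => by
    simp [l₁, ofReal_eq_zero_of_norm_eq_zero (hv₁ e)]
  have zl₂ : ‖h.2‖₊ ^ 2 = 0 → l₂ = 0 := fun e => by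
    simp [l₂, ofReal_eq_zero_of_norm_eq_zero (hv₂ e)]
  have hl₁ : (‖h.1‖ ^ 2 : ℂ) * (l₁ / ‖h.1‖ ^ 2) = l₁ := by
    by_cases e : ‖h.1‖ = 0
    · simp [e, l₁, ofReal_eq_zero_of_norm_eq_zero e]
    · exact mul_div_cancel₀ _ (by exact_mod_cast pow_ne_zero 2 e)
  have hl₂ : (‖h.2‖ ^ 2 : ℂ) * (l₂ / ‖h.2‖ ^ 2) = l₂ := by
    by_cases e : ‖h.2‖ = 0
    · simp [e, l₂, ofReal_eq_zero_of_norm_eq_zero e]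
    · exact mul_div_cancel₀ _ (by exact_mod_cast pow_ne_zero 2 e)
  have m0 := h0.hasExpMoments hs.continuous
  have stein := m0.stein hs.continuous (hx.hasExpMoments (continuous_dx hs)) (continuous_dx hs)
    (hy.hasExpMoments (continuous_dy hs)) (continuous_dy hs) (hasDerivAt_dx hs) (hasDerivAt_dy hs)
    zc zd zl₁ zl₂
  -- Along the curve `(f + s w'/2, g + s w/2)` the Wigner mean moves linearly with velocity `(l₁,
  -- l₂)`; the factor ½ matches the one in `D_k`.
  have hcs : ∀ s : ℝ, wignerMean₁ h (f + (s : ℂ) • ((1 / 2 : ℂ) • w'))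
      (g + (s : ℂ) • ((1 / 2 : ℂ) • w)) / ‖h.1‖ ^ 2 = c + s * (l₁ / ‖h.1‖ ^ 2) := by
    intro s
    simp only [c, l₁, wignerMean₁, hw', hw, annPart, crePart, inner_add_left, inner_add_right,
      inner_smul_left, inner_smul_right, inner_sub_left, inner_sub_right, Complex.conj_I,
      Complex.conj_ofReal, map_div₀, map_one, map_ofNat, inner_bar_ofReal]
    linear_combination (-s * ⟪Cplx.ofReal h.1, k.1⟫_ℂ / ‖h.1‖ ^ 2) * Complex.I_mul_I
  have hds : ∀ s : ℝ, wignerMean₂ h (f + (s : ℂ) • ((1 / 2 : ℂ) • w'))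
      (g + (s : ℂ) • ((1 / 2 : ℂ) • w)) / ‖h.2‖ ^ 2 = d + s * (l₂ / ‖h.2‖ ^ 2) := by
    intro s
    simp only [d, l₂, wignerMean₂, hw', hw, annPart, crePart, inner_add_left, inner_add_right,
      inner_smul_left, inner_smul_right, inner_sub_left, inner_sub_right, Complex.conj_I,
      Complex.conj_ofReal, map_div₀, map_one, map_ofNat, inner_bar_ofReal]
    ring
  -- The matrix element is differentiated at `s = 0` in two ways: here through the exponential
  -- vectors, then through the Gaussian integral and its normalization.
  have d1 := hasDerivAt_matrix (opO h φ) f g ((1 / 2 : ℂ) • w') ((1 / 2 : ℂ) • w)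
  have d2 := m0.hasDerivAt_integral hs.continuous (c' := l₁ / ‖h.1‖ ^ 2) (d' := l₂ / ‖h.2‖ ^ 2)
    zc zd (fun e => by simp [zl₁ e]) (fun e => by simp [zl₂ e])
  have hid := Complex.ofRealCLM.hasDerivAt (x := (0 : ℝ))
  have d3 : HasDerivAt (fun s : ℝ => ⟪f, g⟫_ℂ + s * ((⟪w', g⟫_ℂ + ⟪f, w⟫_ℂ) / 2) +
      s ^ 2 * (⟪w', w⟫_ℂ / 4) - ‖h.1‖ ^ 2 * (c + s * (l₁ / ‖h.1‖ ^ 2)) ^ 2 / 2 -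
      ‖h.2‖ ^ 2 * (d + s * (l₂ / ‖h.2‖ ^ 2)) ^ 2 / 2)
      ((⟪w', g⟫_ℂ + ⟪f, w⟫_ℂ) / 2 - l₁ * c - l₂ * d) 0 := by
    have q1 := (hid.mul_const ((⟪w', g⟫_ℂ + ⟪f, w⟫_ℂ) / 2)).const_add ⟪f, g⟫_ℂ
    have q2 := (hid.pow 2).mul_const (⟪w', w⟫_ℂ / 4)
    have q3 := ((((hid.mul_const (l₁ / ‖h.1‖ ^ 2 : ℂ)).const_add c).pow 2).const_mul
      (‖h.1‖ ^ 2 : ℂ)).div_const 2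
    have q4 := ((((hid.mul_const (l₂ / ‖h.2‖ ^ 2 : ℂ)).const_add d).pow 2).const_mul
      (‖h.2‖ ^ 2 : ℂ)).div_const 2
    refine (((q1.add q2).sub q3).sub q4).congr_deriv ?_
    simp only [Complex.ofRealCLM_apply, Complex.ofReal_zero, Complex.ofReal_one, zero_mul, add_zero]
    push_cast
    linear_combination -c * hl₁ - d * hl₂
  have hconst : ∀ s : ℝ, wignerConst h (f + (s : ℂ) • ((1 / 2 : ℂ) • w'))
      (g + (s : ℂ) • ((1 / 2 : ℂ) • w)) = Complex.exp (⟪f, g⟫_ℂ + s * ((⟪w', g⟫_ℂ + ⟪f, w⟫_ℂ) / 2) +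
      s ^ 2 * (⟪w', w⟫_ℂ / 4) - ‖h.1‖ ^ 2 * (c + s * (l₁ / ‖h.1‖ ^ 2)) ^ 2 / 2 -
      ‖h.2‖ ^ 2 * (d + s * (l₂ / ‖h.2‖ ^ 2)) ^ 2 / 2) := by
    intro s
    rw [wignerConst, hcs, hds]
    congr 3
    simp only [inner_add_left, inner_add_right, inner_smul_left, inner_smul_right,
      Complex.conj_ofReal, map_div₀, map_one, map_ofNat]
    ring
  have d4 := d3.cexp.mul d2
  have hfun : (fun s : ℝ => ⟪expVec (f + (s : ℂ) • ((1 / 2 : ℂ) • w')),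
      opO h φ (expVec (g + (s : ℂ) • ((1 / 2 : ℂ) • w)))⟫_ℂ) = fun s : ℝ =>
      Complex.exp (⟪f, g⟫_ℂ + s * ((⟪w', g⟫_ℂ + ⟪f, w⟫_ℂ) / 2) +
      s ^ 2 * (⟪w', w⟫_ℂ / 4) - ‖h.1‖ ^ 2 * (c + s * (l₁ / ‖h.1‖ ^ 2)) ^ 2 / 2 -
      ‖h.2‖ ^ 2 * (d + s * (l₂ / ‖h.2‖ ^ 2)) ^ 2 / 2) *
      ∫ p, φ p * expWeight (c + s * (l₁ / ‖h.1‖ ^ 2)) (d + s * (l₂ / ‖h.2‖ ^ 2)) p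
        ∂(gaussianPlane (‖h.1‖₊ ^ 2) (‖h.2‖₊ ^ 2)) := by
    funext s
    rw [h0.inner_eq, hconst, wignerWeight, hcs, hds, wignerMeasure]
  rw [hfun] at d1
  have key := d1.unique d4
  have hm0 := h0.inner_eq f g
  have hmx := hx.inner_eq f g
  have hmy := hy.inner_eq f g
  have hC := hconst 0
  simp only [Complex.ofReal_zero, zero_smul, add_zero, zero_mul, creationExp_smul,
    inner_smul_left, inner_smul_right, map_smul, map_div₀, map_one, map_ofNat] at key hC
  rw [← hC] at key
  have h2 := two_mul_dirDerivMatrix k (opO h φ) f g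
  rw [gradComp_add, gradComp_elemTensor, gradComp_elemTensor]
  simp only [inner_zero_right, add_zero, zero_add, _root_.add_apply, _root_.smul_apply,
    inner_add_right, inner_smul_right]
  rw [hm0] at h2
  rw [hmx, hmy]
  simp only [wignerWeight, wignerMeasure] at h2 ⊢
  push_cast [coe_nnnorm] at stein
  -- The derivative of the total mass, `(⟨w', g⟩ + ⟨f, w⟩)/2` times the matrix element, cancels the
  -- scalar terms of the commutator. Stein's identity identifies the rest with the quantizations of
  -- the partial derivatives.
  linear_combination wignerConst h f g * stein - h2 / 2 - key

end QMalliavin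

end

theorem mainTheorem10 {𝔥 : Type*} [NormedAddCommGroup 𝔥] [InnerProductSpace ℝ 𝔥]
    [CompleteSpace 𝔥] [TopologicalSpace.SeparableSpace 𝔥]
    (n : ℕ) (F : Fin n → BFock 𝔥) (h : Fin n → Cplx 𝔥 × Cplx 𝔥)
    (hu : MemDivergenceDomain F h)
    (A B : BFock 𝔥) (DA DB : HModule 𝔥)
    (hA : IsGradient A DA) (hB : IsGradient B DB)
    (hAcomm : ∀ j, CommutesWithField A (h j))
    (hBcomm : ∀ j, CommutesWithField B (h j)) :
    vacuumState (A * divergence F h * B) = vacuumState (twoSidedGrad F h A DA B DB) := by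
  rw [twoSidedGrad, rightGrad_eq, leftGrad_eq]
  exact vacuumState_mul_divergence_mul hu (fun j => hA.isDirDeriv isDirDeriv_opO (h j))
    (fun j => hB.isDirDeriv isDirDeriv_opO (h j)) hAcomm hBcomm
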